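/- Let $k$ be a nonarchimedean local field (for instance $\mathbf{Q}_p$ or $\mathbf{F}_p((T))$) and let $C$ be the completion of an algebraic closure of $k$. Let $S$ be a non-empty finite set, and for each $i\in S$ let $F_i$ be a nonarchimedean local field with a continuous embedding $\iota_i\colon F_i\hookrightarrow C$. Put $G=\prod_{i\in S}\mathrm{PGL}_2(F_i)$; it acts on $\mathbf{P}^1(C)^S$ through the $\iota_i$, and each $\mathbf{P}^1(F_i)$ is regarded as a subset of $\mathbf{P}^1(C)$ through $\iota_i$. For a subgroup $\Gamma\subseteq G$ let $\mathcal{L}_\Gamma\subseteq\mathbf{P}^1(C)^S$ be its set of limit points, i.e. the set of all $x$ for which there are $y\in\mathbf{P}^1(C)^S$ and pairwise distinct $\gamma_1,\gamma_2,\ldots\in\Gamma$ with $\gamma_j(y)\to x$. The subgroup $\Gamma$ is called *plectic* if there are subsets $L_i\subseteq\mathbf{P}^1(F_i)$, $i\in S$ (they are then unique), with $$\mathcal{L}_\Gamma=\bigcup_{i\in S}\Big(L_i\times\prod_{j\in S\setminus\{i\}}\mathbf{P}^1(C)\Big),$$ and *semi-simple* if moreover $|L_i|\neq 1$ for all $i\in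 S$. Let $\Gamma$ be plectic and semi-simple. If $L_i=\emptyset$, let $\mathcal{T}_i$ be a single vertex. Otherwise let $\mathcal{T}_i$ be the smallest subtree of the Bruhat–Tits tree of $\mathrm{PGL}_2(F_i)$ whose set of ends is $L_i$, where the ends of the Bruhat–Tits tree are identified with $\mathbf{P}^1(F_i)$ (if $|L_i|=2$, this is the infinite geodesic joining the two points of $L_i$). The group $\Gamma$ acts on the polysimplicial complex $\mathcal{T}_\Gamma=\prod_{i\in S}\mathcal{T}_i$, and $\Gamma$ is called a *normal plectic subgroup* if the quotient $\Gamma\backslash\mathcal{T}_\Gamma$ is finite, i.e. if there are only finitely many $\Gamma$-orbits of polysimplices of $\mathcal{T}_\Gamma$. **Proposition.** Every normal plectic subgroup $\Gamma\subseteq G$ is finitely presented. -/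

import Mathlib

open scoped Pointwise MatrixGroups LinearAlgebra.Projectivization ValuativeRel Topology

namespace Plectic

noncomputable section

/-! ### The field `C` -/

section CompletedAlgebraicClosure

variable (k : Type*) [NontriviallyNormedField k] [IsUltrametricDist k] [ProperSpace k]

/-- The algebraic closure of a nonarchimedean local field `k` (with a chosen absolute value),
normed by the unique extension of the absolute value of `k`. -/
instance algebraicClosureNormedField : NormedField (AlgebraicClosure k) :=
  spectralNorm.normedField k (AlgebraicClosure k)

/-- The completion `C` of the algebraic closure of a nonarchimedean local field `k`. -/
abbrev CompletedAlgClosure : Type _ := UniformSpace.Completion (AlgebraicClosure k)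

end CompletedAlgebraicClosure

/-! ### Projective lines -/

section ProjectiveLine

/-- The projective line `ℙ¹(K)`: the set of lines through the origin in `K²`. -/
abbrev ProjLine (K : Type*) [Field K] : Type _ := ℙ K (Fin 2 → K)

/-- The topology of `ℙ¹(K)`: the quotient topology of `K² ∖ {0}`. -/
instance projLineTopology (K : Type*) [Field K] [TopologicalSpace K] :
    TopologicalSpace (ProjLine K) :=
  TopologicalSpace.coinduced (Projectivization.mk' K) inferInstance

variable {F C : Type*} [Field F] [Field C]

/-- The map `ℙ¹(F) → ℙ¹(C)` induced by an embedding of fields `F → C`. -/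
def projLineMap (ι : F →+* C) : ProjLine F → ProjLine C :=
  Projectivization.map
    ({ toFun := fun v j => ι (v j)
       map_add' := fun _ _ => funext fun _ => map_add ι _ _
       map_smul' := fun _ _ => funext fun _ => map_mul ι _ _ } : (Fin 2 → F) →ₛₗ[ι] (Fin 2 → C))
    (fun _ _ h => funext fun j => ι.injective (congrFun h j))

end ProjectiveLine

/-! ### The Bruhat–Tits tree of `PGL₂(F)` -/

section Tree

theorem scalar_comm {F : Type*} [Field F] (c : Fˣ) (g : GL (Fin 2) F) :
    Matrix.GeneralLinearGroup.scalar (Fin 2) c * g =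
      g * Matrix.GeneralLinearGroup.scalar (Fin 2) c := by
  ext i j; simp [mul_comm]

variable (F : Type*) [Field F] [ValuativeRel F]

/-- The valuation ring of `F` is local (a shortcut for instance search). -/
instance isLocalRing_integer : IsLocalRing 𝒪[F] :=
  ValuationRing.isLocalRing 𝒪[F]

/-- Lattices in `F²`: finitely generated submodules over the valuation ring which span `F²`. -/
def OLattice : Type _ := {Λ : Submodule 𝒪[F] (Fin 2 → F) // Λ.IsLattice F}

variable {F}

/-- The endomorphism of `F²`, as a module over the valuation ring, given by a matrix. -/
def intLin (g : GL (Fin 2) F) : (Fin 2 → F) →ₗ[𝒪[F]] (Fin 2 → F) :=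
  (Matrix.toLin' (g : Matrix (Fin 2) (Fin 2) F)).restrictScalars 𝒪[F]

theorem intLin_one : intLin (1 : GL (Fin 2) F) = LinearMap.id := by
  ext; simp [intLin]

theorem intLin_mul (g h : GL (Fin 2) F) : intLin (g * h) = (intLin g).comp (intLin h) := by
  ext; simp [intLin]

theorem isLattice_map (g : GL (Fin 2) F) {Λ : Submodule 𝒪[F] (Fin 2 → F)}
    (hΛ : Λ.IsLattice F) : (Λ.map (intLin g)).IsLattice F where
  fg := hΛ.fg.map _
  span_eq_top := by
    have h1 : ((Λ.map (intLin g) : Submodule 𝒪[F] (Fin 2 → F)) : Set (Fin 2 → F)) =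
        Matrix.toLin' (g : Matrix (Fin 2) (Fin 2) F) '' (Λ : Set (Fin 2 → F)) := rfl
    rw [h1, Submodule.span_image, hΛ.span_eq_top, Submodule.map_top, LinearMap.range_eq_top]
    intro v
    refine ⟨Matrix.toLin' ((g⁻¹ : GL (Fin 2) F) : Matrix (Fin 2) (Fin 2) F) v, ?_⟩
    rw [← Matrix.toLin'_mul_apply, ← Units.val_mul, mul_inv_cancel]
    simp

/-- `GL₂(F)` acts on lattices by `g • Λ = g(Λ)`. -/
instance latticeAction : MulAction (GL (Fin 2) F) (OLattice F) where
  smul g Λ := ⟨Λ.1.map (intLin g), isLattice_map g Λ.2⟩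
  one_smul Λ := Subtype.ext <| by
    change Λ.1.map (intLin 1) = Λ.1
    rw [intLin_one, Submodule.map_id]
  mul_smul g h Λ := Subtype.ext <| by
    change Λ.1.map (intLin (g * h)) = (Λ.1.map (intLin h)).map (intLin g)
    rw [intLin_mul, Submodule.map_comp]

/-- Two lattices are homothetic if they differ by a scalar `c ∈ Fˣ`. -/
def homothety : Setoid (OLattice F) where
  r Λ Λ' := ∃ c : Fˣ, Matrix.GeneralLinearGroup.scalar (Fin 2) c • Λ = Λ'
  iseqv :=
    { refl := fun Λ => ⟨1, by rw [map_one, one_smul]⟩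
      symm := by
        rintro Λ _ ⟨c, rfl⟩
        exact ⟨c⁻¹, by rw [map_inv, inv_smul_smul]⟩
      trans := by
        rintro Λ _ _ ⟨c, rfl⟩ ⟨d, rfl⟩
        exact ⟨d * c, by rw [map_mul, mul_smul]⟩ }

variable (F) in
/-- Vertices of the Bruhat–Tits tree: homothety classes of lattices in `F²`. -/
def Vertex : Type _ := Quotient (homothety (F := F))

/-- The homothety class of a lattice. -/
def OLattice.cls (Λ : OLattice F) : Vertex F := Quotient.mk homothety Λ

/-- The action of `GL₂(F)` on homothety classes of lattices. -/
instance vertexActionGL : MulAction (GL (Fin 2) F) (Vertex F) where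
  smul g := Quotient.map (fun Λ => g • Λ) <| by
    rintro Λ _ ⟨c, rfl⟩
    exact ⟨c, by rw [smul_smul, smul_smul, scalar_comm]⟩
  one_smul v := by
    induction v using Quotient.inductionOn with
    | h Λ => exact congrArg (Quotient.mk _) (one_smul _ Λ)
  mul_smul g h v := by
    induction v using Quotient.inductionOn with
    | h Λ => exact congrArg (Quotient.mk _) (mul_smul g h Λ)

/-- The action of `PGL₂(F)` on the vertices of the Bruhat–Tits tree. -/
instance vertexAction : MulAction PGL(2, F) (Vertex F) :=
  Matrix.ProjGenLinGroup.mulActionOfGL fun c v => by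
    induction v using Quotient.inductionOn with
    | h Λ => exact (Quotient.sound ⟨c, rfl⟩ : Λ.cls = OLattice.cls _).symm

variable (F) in
/-- The Bruhat–Tits tree of `PGL₂(F)`: two vertices are joined by an edge if they have
representatives `Λ, Λ'` with `𝔪Λ ⊊ Λ' ⊊ Λ`. (This relation is already symmetric.) -/
def bruhatTits : SimpleGraph (Vertex F) :=
  SimpleGraph.fromRel fun v w => ∃ Λ Λ' : OLattice F,
    Λ.cls = v ∧ Λ'.cls = w ∧ 𝓂[F] • Λ.1 < Λ'.1 ∧ Λ'.1 < Λ.1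

/-- `IsHalfLine r ℓ`: the classes of the lattices `r 0, r 1, …` form the infinite half-line of the
Bruhat–Tits tree from the class of `r 0` to the end which corresponds to `ℓ ∈ ℙ¹(F)`, that is,
`r n = (r 0 ∩ ℓ) + 𝔪ⁿ (r 0)`. Every half-line is of this form for a unique `ℓ`, and two half-lines
have the same `ℓ` if and only if they share a common tail. -/
def IsHalfLine (r : ℕ → OLattice F) (ℓ : ProjLine F) : Prop :=
  ∀ n, (r n).1 = ((r 0).1 ⊓ ℓ.submodule.restrictScalars 𝒪[F]) ⊔ 𝓂[F] ^ n • (r 0).1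

/-- The set of ends of a subgraph `T` of the Bruhat–Tits tree, as a subset of `ℙ¹(F)`. -/
def ends (T : (bruhatTits F).Subgraph) : Set (ProjLine F) :=
  {ℓ | ∃ r : ℕ → OLattice F, IsHalfLine r ℓ ∧ ∀ n, T.Adj (r n).cls (r (n + 1)).cls}

/-- The smallest subtree (connected subgraph) of the Bruhat–Tits tree whose set of ends is `L`.
If `L` consists of two points, this is the infinite geodesic which joins them. -/
def hull (L : Set (ProjLine F)) : (bruhatTits F).Subgraph :=
  sInf {T | T.Connected ∧ ends T = L}

/-- The simplices of the tree `T_L` attached to `L ⊆ ℙ¹(F)`, as sets of vertices.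
If `L` is empty, `T_L` consists of the single vertex `none`; otherwise `T_L` is `hull L`, whose
vertices `v` are written `some v`. -/
def treeSimplices (L : Set (ProjLine F)) : Set (Set (Option (Vertex F))) :=
  {s | (L = ∅ ∧ s = {none}) ∨
    (L.Nonempty ∧ ((∃ v ∈ (hull L).verts, s = {some v}) ∨
      ∃ v w, (hull L).Adj v w ∧ s = {some v, some w}))}

end Tree

/-! ### Plectic subgroups -/

section PlecticSubgroups

variable {S : Type*} {F : S → Type*} [∀ i, Field (F i)]
  {C : Type*} [Field C]

/-- The action of `PGL₂(F_S) = ∏ PGL₂(F_i)` on `ℙ¹(C_S) = ∏ ℙ¹(C)` induced by the embeddings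
`ι i : F i → C`. -/
def act (ι : ∀ i, F i →+* C) (g : ∀ i, PGL(2, F i)) (x : S → ProjLine C) : S → ProjLine C :=
  fun i => (Matrix.ProjGenLinGroup.map (ι i) (g i) : PGL(2, C)) • x i

/-- The limit points of `Γ` in `ℙ¹(C_S)`: limits of sequences `γ_j(y)` with pairwise distinct
`γ_j ∈ Γ`. -/
def limitPoints [TopologicalSpace C] (ι : ∀ i, F i →+* C) (Γ : Subgroup (∀ i, PGL(2, F i))) :
    Set (S → ProjLine C) :=
  {x | ∃ (y : S → ProjLine C) (γ : ℕ → ∀ i, PGL(2, F i)), Function.Injective γ ∧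
    (∀ j, γ j ∈ Γ) ∧ Filter.Tendsto (fun j => act ι (γ j) y) Filter.atTop (𝓝 x)}

/-- `L i ⊆ ℙ¹(F i)` are the local limit sets of `Γ`: the limit set of `Γ` is the union over `i` of
the sets `L i × ∏_{j ≠ i} ℙ¹(C)`. The group `Γ` is plectic if such a family exists. A family `L` with
this property is unique (as no map `ℙ¹(F i) → ℙ¹(C)` is surjective in the cases of interest). -/
def HasLocalLimitSets [TopologicalSpace C] (ι : ∀ i, F i →+* C)
    (Γ : Subgroup (∀ i, PGL(2, F i))) (L : ∀ i, Set (ProjLine (F i))) : Prop :=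
  limitPoints ι Γ = {x | ∃ i, x i ∈ projLineMap (ι i) '' L i}

variable [∀ i, ValuativeRel (F i)]

/-- The polysimplices of the product over `i` of the trees attached to `L i`: families consisting of
a simplex in each tree. -/
def polysimplices (L : ∀ i, Set (ProjLine (F i))) : Set (∀ i, Set (Option (Vertex (F i)))) :=
  {σ | ∀ i, σ i ∈ treeSimplices (L i)}

/-- The quotient by `Γ` of the product of the trees attached to `L i` is a finite complex: there are
finitely many `Γ`-orbits of polysimplices. The action is the vertexwise one, where the vertex of a
one-vertex tree is fixed. -/
def FiniteQuotient (Γ : Subgroup (∀ i, PGL(2, F i))) (L : ∀ i, Set (ProjLine (F i))) : Prop :=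
  Set.Finite ((Quotient.mk (MulAction.orbitRel Γ (∀ i, Set (Option (Vertex (F i)))))) ''
    polysimplices L)

/-- Normal plectic subgroups: `Γ` is plectic, semi-simple (no local limit set is a single point),
and its quotient of the associated product of trees is finite. -/
def IsNormalPlectic [TopologicalSpace C] (ι : ∀ i, F i →+* C)
    (Γ : Subgroup (∀ i, PGL(2, F i))) : Prop :=
  ∃ L, HasLocalLimitSets ι Γ L ∧ (∀ i, (L i).encard ≠ 1) ∧ FiniteQuotient Γ L

end PlecticSubgroups

end

end Plectic

/-! The group acts on the product of trees, which is contractible, with finitely many orbits of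
polysimplices. Once vertex stabilizers are known to be finite, the action is proper and cocompact,
and finite presentation follows from the classical theorem on such actions.

Finiteness of stabilizers is where the limit set enters (`HasLocalLimitSets.finite_stabilizer`). An
infinite stabilizer would contain a sequence of distinct elements. Choose a point `y` that is `F
i`-rational where `L i` is empty and irrational where it is not. At each `i` the orbit of `y i`
stays in a compact set, because `ℙ¹(F i)` is compact and because vertex stabilizers in `PGL₂(F i)`
are compact. A subsequence converges to a limit point, and this point is irrational wherever `L i`
is nonempty, so it has no coordinate in any `L i`. That is a contradiction. Irrational points exist
because `F i` does not fill `C` (`exists_notMem_range`).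

Contractibility is used in combinatorial form (`GraphContraction`). In each tree, every vertex moves
one step towards a root on a geodesic between two ends (`exists_treeContraction`), and these maps
are combined coordinatewise. Since such a contraction turns every cocycle into a coboundary, the
finitely many elements that move a finite fundamental set to a neighbour of itself, with the
products visible among them, present the group (`Group.IsFinitelyPresented.of_graphContraction`). -/

section FinitePresentation

/-! ### Finite presentation from a proper cocompact action on a contractible graph. -/

/-- A contraction of a graph (a reflexive symmetric relation `adj`) to the vertex `o`: a map `r`
which moves vertices to neighbours, has `o` as its eventual value everywhere, and is such that every
square `v, r v, r w, w` over an edge has a vertex adjacent to its four corners. -/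
structure GraphContraction {V : Type*} (adj : V → V → Prop) (r : V → V) (o : V) : Prop where
  refl : ∀ v, adj v v
  symm : ∀ v w, adj v w → adj w v
  adj_map : ∀ v, adj v (r v)
  map_root : r o = o
  iterate_eq : ∀ v, ∃ n, r^[n] v = o
  square : ∀ v w, adj v w → adj (r v) (r w) ∧
    ∃ u, adj v u ∧ adj w u ∧ adj (r v) u ∧ adj (r w) u

namespace GraphContraction

variable {V : Type*} {adj : V → V → Prop} {r : V → V} {o : V}

/-- The product of the values of `c` along the path `v, r v, …, r^[n] v`. -/
def pathProd {H : Type*} [Group H] (c : V → V → H) (r : V → V) : ℕ → V → H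
  | 0, _ => 1
  | n + 1, v => c v (r v) * pathProd c r n (r v)

/-- Joining its corners to the vertex `u` cuts each square `v, r v, r w, w` into triangles, so the
cocycle takes the same value along both routes from `v` to `r w`. Stacking these squares compares
the two paths to `o`. -/
theorem pathProd_eq (h : GraphContraction adj r o) {H : Type*} [Group H] {c : V → V → H}
    (hc : ∀ x y z, adj x y → adj y z → adj x z → c x y * c y z = c x z) (n : ℕ) :
    ∀ v w, adj v w → r^[n] v = o → r^[n] w = o →
      pathProd c r n v = c v w * pathProd c r n w := by
  have hone : ∀ v, c v v = 1 := fun v => by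
    simpa using hc v v v (h.refl v) (h.refl v) (h.refl v)
  induction n with
  | zero =>
    intro v w _ hv hw
    simp only [Function.iterate_zero, id_eq] at hv hw
    subst hv hw
    simp [pathProd, hone]
  | succ n ih =>
    intro v w hvw hv hw
    obtain ⟨hr, u, hvu, hwu, hru, hsu⟩ := h.square v w hvw
    have key : ∀ x y z, adj x u → adj y u → adj z u → adj x y → adj y z →
        c x y * c y z = c x u * c u z := by
      intro x y z hx hy hz hxy hyz
      rw [← hc x u y hx (h.symm _ _ hy) hxy, ← hc y u z hy (h.symm _ _ hz) hyz, mul_assoc,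
        ← mul_assoc (c u y), hc u y u (h.symm _ _ hy) hy (h.refl u), hone, one_mul]
    simp only [Function.iterate_succ, Function.comp_apply] at hv hw
    rw [pathProd, pathProd, ih _ _ hr hv hw, ← mul_assoc, ← mul_assoc,
      key v (r v) (r w) hvu hru hsu (h.adj_map v) hr,
      key v w (r w) hvu hwu hsu hvw (h.adj_map w)]

theorem iterate_add (h : GraphContraction adj r o) {n : ℕ} {v : V} (hv : r^[n] v = o) (m : ℕ) :
    r^[m + n] v = o := by
  rw [Function.iterate_add_apply, hv, Function.iterate_fixed h.map_root]

/-- Every cocycle on a contractible graph is a coboundary. -/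
theorem exists_primitive (h : GraphContraction adj r o) {H : Type*} [Group H] {c : V → V → H}
    (hc : ∀ x y z, adj x y → adj y z → adj x z → c x y * c y z = c x z) :
    ∃ f : V → H, ∀ v w, adj v w → f v * c v w = f w := by
  have hone : ∀ v, c v v = 1 := fun v => by
    simpa using hc v v v (h.refl v) (h.refl v) (h.refl v)
  choose N hN using h.iterate_eq
  have stable : ∀ n v, r^[n] v = o → pathProd c r (n + 1) v = pathProd c r n v := by
    intro n
    induction n with
    | zero =>
      intro v hv
      simp only [Function.iterate_zero, id_eq] at hv
      subst hv
      simp [pathProd, h.map_root, hone]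
    | succ n ih =>
      intro v hv
      rw [pathProd, ih (r v) (by simpa using hv), pathProd]
  have stable' : ∀ m v, pathProd c r (m + N v) v = pathProd c r (N v) v := by
    intro m v
    induction m with
    | zero => simp
    | succ m ih => rw [← ih, add_right_comm, stable _ _ (h.iterate_add (hN v) m)]
  -- Prolonging a path beyond `o` only adds factors `c o o = 1`, so the paths from `v` and `w` can
  -- be given the common length `N w + N v`.
  refine ⟨fun v => (pathProd c r (N v) v)⁻¹, fun v w hvw => ?_⟩
  have := h.pathProd_eq hc (N w + N v) v w hvw (h.iterate_add (hN v) _)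
    (by rw [add_comm]; exact h.iterate_add (hN w) _)
  rw [stable', add_comm, stable'] at this
  simp only [this]
  group

end GraphContraction

/-- The group presented by the products which stay inside a subset `S` of a group. -/
abbrev PartialProductGroup {Γ : Type*} [Group Γ] (S : Set Γ) : Type _ :=
  PresentedGroup (Set.range fun p : {p : S × S // (p.1 * p.2 : Γ) ∈ S} =>
    FreeGroup.of p.1.1 * FreeGroup.of p.1.2 * (FreeGroup.of ⟨_, p.2⟩)⁻¹)

namespace PartialProductGroup

variable {Γ : Type*} [Group Γ] (S : Set Γ)

open Classical in
/-- The generator attached to an element of `S`. -/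
noncomputable def gen (γ : Γ) : PartialProductGroup S :=
  if h : γ ∈ S then PresentedGroup.of ⟨γ, h⟩ else 1

theorem gen_mul {s t : Γ} (hs : s ∈ S) (ht : t ∈ S) (hst : s * t ∈ S) :
    gen S s * gen S t = gen S (s * t) := by
  rw [gen, gen, gen, dif_pos hs, dif_pos ht, dif_pos hst, ← mul_inv_eq_one]
  exact PresentedGroup.one_of_mem (Set.mem_range.mpr ⟨⟨(⟨s, hs⟩, ⟨t, ht⟩), hst⟩, rfl⟩)

/-- The canonical homomorphism. -/
noncomputable def toGroup : PartialProductGroup S →* Γ :=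
  PresentedGroup.toGroup (f := fun s : S => (s : Γ)) <| by
    rintro _ ⟨p, rfl⟩
    simp

theorem toGroup_gen {s : Γ} (hs : s ∈ S) : toGroup S (gen S s) = s := by
  rw [gen, dif_pos hs, toGroup, PresentedGroup.toGroup.of]

theorem induction_on {p : PartialProductGroup S → Prop} (h : PartialProductGroup S) (one : p 1)
    (mul_gen : ∀ x, ∀ s ∈ S, p x → p (x * gen S s))
    (mul_gen_inv : ∀ x, ∀ s ∈ S, p x → p (x * (gen S s)⁻¹)) : p h := by
  have key : h ∈ Subgroup.closure (Set.range (PresentedGroup.of :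
      S → PartialProductGroup S)) := by
    rw [PresentedGroup.closure_range_of]; trivial
  have hg : ∀ s : S, (PresentedGroup.of s : PartialProductGroup S) = gen S s := fun s => by
    rw [gen, dif_pos s.2]
  induction key using Subgroup.closure_induction_right with
  | one => exact one
  | mul_right x hx y hy ih =>
    obtain ⟨s, rfl⟩ := hy
    rw [hg]
    exact mul_gen _ _ s.2 ih
  | mul_inv_cancel x hx y hy ih =>
    obtain ⟨s, rfl⟩ := hy
    rw [hg]
    exact mul_gen_inv _ _ s.2 ih

end PartialProductGroup

open PartialProductGroup in
/-- A group which acts properly and cocompactly on a contractible graph is finitely presented. -/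
theorem Group.IsFinitelyPresented.of_graphContraction {Γ V : Type*} [Group Γ] [MulAction Γ V]
    {adj : V → V → Prop} {r : V → V} {o : V} (h : GraphContraction adj r o)
    (hadj : ∀ (γ : Γ) v w, adj v w → adj (γ • v) (γ • w))
    {D₀ : Set V} (hD₀ : D₀.Finite) (hcov : ∀ v, ∃ γ : Γ, ∃ d ∈ D₀, γ • d = v)
    (hfin : ∀ d d' : V, {γ : Γ | adj (γ • d) d'}.Finite) :
    Group.IsFinitelyPresented Γ := by
  -- The fundamental set is enlarged to be stable under `r` and to contain `o`, so that any of its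
  -- points can be joined to `o` inside it.
  obtain ⟨D, hDfin, hD₀D, hDr, hoD⟩ : ∃ D : Set V, D.Finite ∧ D₀ ⊆ D ∧ (∀ d ∈ D, r d ∈ D) ∧
      o ∈ D := by
    choose N hN using h.iterate_eq
    refine ⟨insert o (⋃ d ∈ D₀, (fun n => r^[n] d) '' Set.Iic (N d)), ?_, ?_, ?_, by simp⟩
    · exact (hD₀.biUnion fun d _ => (Set.finite_Iic _).image _).insert o
    · intro d hd
      exact Or.inr (Set.mem_biUnion hd ⟨0, by simp, rfl⟩)
    · rintro d (rfl | hd)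
      · exact Or.inl h.map_root
      · simp only [Set.mem_iUnion] at hd
        obtain ⟨e, he, n, hn, rfl⟩ := hd
        rcases Nat.lt_or_ge n (N e) with hlt | hge
        · refine Or.inr (Set.mem_biUnion he ⟨n + 1, hlt, ?_⟩)
          exact Function.iterate_succ_apply' r n e
        · have : n = N e := le_antisymm hn hge
          subst this
          left
          simp only [hN, h.map_root]
  set S : Set Γ := {γ | ∃ d ∈ D, ∃ d' ∈ D, adj (γ • d) d'} with hS
  have hSfin : S.Finite := by
    have : S = ⋃ d ∈ D, ⋃ d' ∈ D, {γ : Γ | adj (γ • d) d'} := by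
      ext γ; simp [hS]
    rw [this]
    exact hDfin.biUnion fun d _ => hDfin.biUnion fun d' _ => hfin d d'
  have hS1 : ∀ {γ : Γ} {d d' : V}, d ∈ D → d' ∈ D → adj (γ • d) d' → γ ∈ S :=
    fun hd hd' ha => ⟨_, hd, _, hd', ha⟩
  have hS2 : ∀ {γ δ : Γ} {d d' : V}, d ∈ D → d' ∈ D → adj (γ • d) (δ • d') → δ⁻¹ * γ ∈ S := by
    intro γ δ d d' hd hd' ha
    refine hS1 hd hd' ?_
    simpa [mul_smul] using hadj δ⁻¹ _ _ ha
  choose g d hd hgd using hcov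
  replace hd : ∀ v, d v ∈ D := fun v => hD₀D (hd v)
  have hstep : ∀ v w, adj v w → (g v)⁻¹ * g w ∈ S := fun v w hvw => by
    refine hS2 (hd w) (hd v) ?_
    rw [hgd, hgd]
    exact h.symm _ _ hvw
  have hlast : ∀ (γ : Γ), ∀ e ∈ D, (g (γ • e))⁻¹ * γ ∈ S := fun γ e he => by
    refine hS2 he (hd (γ • e)) ?_
    rw [hgd]
    exact h.refl _
  -- The transition elements `(g v)⁻¹ * g w` lie in `S`, and their triangle relations are among the
  -- defining ones. They therefore lift to a cocycle in the presented group, and `f` plays the role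
  -- of a lift of `g`.
  obtain ⟨f, hf⟩ := h.exists_primitive (c := fun v w => gen S ((g v)⁻¹ * g w)) <| by
    intro x y z hxy hyz hxz
    have hprod : (g x)⁻¹ * g y * ((g y)⁻¹ * g z) = (g x)⁻¹ * g z := by group
    rw [gen_mul S (hstep x y hxy) (hstep y z hyz) (by rw [hprod]; exact hstep x z hxz), hprod]
  -- A candidate lift of `γ`, read off at the point `γ • e`. It inverts `toGroup S` up to a left
  -- translation, which is enough for injectivity.
  set σ : V → Γ → PartialProductGroup S := fun e γ => f (γ • e) * gen S ((g (γ • e))⁻¹ * γ)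
    with hσ
  have hσ_mul : ∀ e ∈ D, ∀ e' ∈ D, ∀ γ s, adj (s • e) e' →
      σ e (γ * s) = σ e' γ * gen S s := by
    intro e he e' he' γ s hs
    have hvw : adj (γ • e') ((γ * s) • e) := by
      rw [mul_smul]
      exact h.symm _ _ (hadj γ _ _ hs)
    have hsS : s ∈ S := hS1 he he' hs
    have h3 : (g (γ • e'))⁻¹ * (γ * s) ∈ S := by
      refine hS2 he (hd (γ • e')) ?_
      rw [hgd]
      exact h.symm _ _ hvw
    have h4 : (g (γ • e'))⁻¹ * g ((γ * s) • e) * ((g ((γ * s) • e))⁻¹ * (γ * s)) =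
      (g (γ • e'))⁻¹ * (γ * s) := by group
    have h5 : (g (γ • e'))⁻¹ * γ * s = (g (γ • e'))⁻¹ * (γ * s) := by group
    simp only [hσ]
    rw [← hf _ _ hvw, mul_assoc, mul_assoc,
      gen_mul S (hstep _ _ hvw) (hlast _ e he) (by rw [h4]; exact h3), h4,
      gen_mul S (hlast γ e' he') hsS (by rw [h5]; exact h3), h5]
  have hgen_one : gen S 1 = 1 := by
    have h1 : (1 : Γ) ∈ S := hS1 hoD hoD (by rw [one_smul]; exact h.refl o)
    simpa using gen_mul S h1 h1 (by simpa using h1)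
  -- The choice of `e` is immaterial: `hσ_mul` with `s = 1` passes from `e` to `r e`, and iteration
  -- reaches `o`.
  have hσ_root : ∀ e ∈ D, ∀ γ, σ e γ = σ o γ := by
    intro e he γ
    have hstep' : ∀ e ∈ D, σ e γ = σ (r e) γ := fun e he => by
      simpa [hgen_one] using hσ_mul e he (r e) (hDr e he) γ 1 (by simpa using h.adj_map e)
    have hiter : ∀ n, r^[n] e ∈ D ∧ σ (r^[n] e) γ = σ e γ := by
      intro n
      induction n with
      | zero => exact ⟨he, rfl⟩
      | succ n ih =>
        rw [Function.iterate_succ_apply']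
        exact ⟨hDr _ ih.1, by rw [← hstep' _ ih.1, ih.2]⟩
    obtain ⟨n, hn⟩ := h.iterate_eq e
    rw [← (hiter n).2, hn]
  have hσ_gen : ∀ γ, ∀ s ∈ S, σ o (γ * s) = σ o γ * gen S s := by
    rintro γ s ⟨e, he, e', he', hs⟩
    rw [← hσ_root e he, ← hσ_root e' he', hσ_mul e he e' he' γ s hs]
  have hσ_toGroup : ∀ x, σ o (toGroup S x) = σ o 1 * x := by
    intro x
    induction x using PartialProductGroup.induction_on with
    | one => simp
    | mul_gen x s hs ih => rw [map_mul, toGroup_gen S hs, hσ_gen _ s hs, ih, mul_assoc]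
    | mul_gen_inv x s hs ih =>
      have := hσ_gen (toGroup S (x * (gen S s)⁻¹)) s hs
      rw [map_mul, map_inv, toGroup_gen S hs, inv_mul_cancel_right, ih] at this
      rw [map_mul, map_inv, toGroup_gen S hs, ← mul_assoc, this, mul_inv_cancel_right]
  have hinj : Function.Injective (toGroup S) := by
    intro x y hxy
    have := hσ_toGroup x
    rw [hxy, hσ_toGroup y] at this
    exact (mul_left_cancel this).symm
  have hmem : ∀ s ∈ S, s ∈ (toGroup S).range := fun s hs => ⟨_, toGroup_gen S hs⟩
  -- Surjectivity: along the path `v, r v, …, o` consecutive values of `g` differ by elements of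
  -- `S`.
  have hg_mem : ∀ n v, r^[n] v = o → g v ∈ (toGroup S).range := by
    intro n
    induction n with
    | zero =>
      intro v hv
      refine hmem _ (hS1 (hd v) hoD ?_)
      rw [hgd, ← hv]
      exact h.refl v
    | succ n ih =>
      intro v hv
      have h1 := ih (r v) (by simpa using hv)
      have h2 := hmem _ (hstep v (r v) (h.adj_map v))
      have h3 := mul_mem h1 (inv_mem h2)
      simpa using h3
  have hsurj : Function.Surjective (toGroup S) := by
    intro γ
    obtain ⟨n, hn⟩ := h.iterate_eq (γ • o)
    have := mul_mem (hg_mem n _ hn) (hmem _ (hlast γ o hoD))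
    simpa using this
  have : Finite S := hSfin
  exact Group.IsFinitelyPresented.equiv (MulEquiv.ofBijective (toGroup S) ⟨hinj, hsurj⟩)

end FinitePresentation

namespace Plectic

/-! ### Lattices and their normal form relative to a root lattice. -/

section RootedTree

open Submodule

variable {F : Type*} [Field F] [ValuativeRel F]

theorem intLin_scalar (c : Fˣ) (x : Fin 2 → F) :
    intLin (Matrix.GeneralLinearGroup.scalar (Fin 2) c) x = (c : F) • x := by
  ext j
  fin_cases j <;> simp [intLin, Matrix.mulVec, dotProduct]

theorem smul_val (g : GL (Fin 2) F) (Λ : OLattice F) : (g • Λ).1 = Λ.1.map (intLin g) := rfl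

theorem span_pair_le {x y : Fin 2 → F} {M : Submodule 𝒪[F] (Fin 2 → F)} :
    span 𝒪[F] {x, y} ≤ M ↔ x ∈ M ∧ y ∈ M := by
  rw [span_le, Set.insert_subset_iff, Set.singleton_subset_iff]; rfl

theorem map_span_pair (f : (Fin 2 → F) →ₗ[𝒪[F]] (Fin 2 → F)) (x y : Fin 2 → F) :
    (span 𝒪[F] {x, y}).map f = span 𝒪[F] {f x, f y} := by
  rw [map_span, Set.image_pair]

theorem coe_smul (t : 𝒪[F]) (x : Fin 2 → F) : (t : F) • x = t • x := rfl

/-- The vertex `v` is the class of the lattice spanned by `x` and `y`. -/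
def IsClassOf (v : Vertex F) (x y : Fin 2 → F) : Prop :=
  ∃ Λ : OLattice F, Λ.1 = span 𝒪[F] {x, y} ∧ Λ.cls = v

theorem IsClassOf.unique {v w : Vertex F} {x y x' y' : Fin 2 → F} (hv : IsClassOf v x y)
    (hw : IsClassOf w x' y') (h : span 𝒪[F] {x, y} = span 𝒪[F] {x', y'}) : v = w := by
  obtain ⟨Λ, hΛ, rfl⟩ := hv
  obtain ⟨Λ', hΛ', rfl⟩ := hw
  congr 1
  exact Subtype.ext (by rw [hΛ, hΛ', h])

theorem IsClassOf.congr {v : Vertex F} {x y x' y' : Fin 2 → F} (hv : IsClassOf v x y)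
    (h : span 𝒪[F] {x, y} = span 𝒪[F] {x', y'}) : IsClassOf v x' y' := by
  obtain ⟨Λ, hΛ, rfl⟩ := hv
  exact ⟨Λ, by rw [hΛ, h], rfl⟩

theorem isClassOf_iff {v : Vertex F} {x y : Fin 2 → F} {c : F} (hc : c ≠ 0) :
    IsClassOf v (c • x) (c • y) ↔ IsClassOf v x y := by
  have key : ∀ {c : F} (_ : c ≠ 0) {x y}, IsClassOf v x y → IsClassOf v (c • x) (c • y) := by
    rintro c hc x y ⟨Λ, hΛ, rfl⟩
    refine ⟨Matrix.GeneralLinearGroup.scalar (Fin 2) (Units.mk0 c hc) • Λ, ?_, ?_⟩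
    · rw [smul_val, hΛ, map_span_pair, intLin_scalar, intLin_scalar]; rfl
    · exact Quotient.sound ((homothety (F := F)).symm ⟨_, rfl⟩)
  refine ⟨fun h => ?_, key hc⟩
  simpa [smul_smul, hc] using key (inv_ne_zero hc) h

theorem IsClassOf.exists_scalar {v : Vertex F} {x y x' y' : Fin 2 → F} (hv : IsClassOf v x y)
    (hv' : IsClassOf v x' y') :
    ∃ c : F, c ≠ 0 ∧ span 𝒪[F] {c • x, c • y} = span 𝒪[F] {x', y'} := by
  obtain ⟨Λ, hΛ, rfl⟩ := hv
  obtain ⟨Λ', hΛ', h⟩ := hv'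
  obtain ⟨c, hc⟩ := Quotient.exact h.symm
  refine ⟨c, c.ne_zero, ?_⟩
  rw [← hΛ', ← hc, smul_val, hΛ, map_span_pair, intLin_scalar, intLin_scalar]

theorem isLattice_span_pair {x y : Fin 2 → F} (h : LinearIndependent F ![x, y]) :
    (span 𝒪[F] {x, y}).IsLattice F where
  fg := fg_span (by simp)
  span_eq_top := by
    rw [span_span_of_tower]
    have := h.span_eq_top_of_card_eq_finrank (by simp)
    simpa [Matrix.range_cons, Set.pair_comm] using this

theorem exists_isClassOf {x y : Fin 2 → F} (h : LinearIndependent F ![x, y]) :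
    ∃ v, IsClassOf v x y :=
  ⟨_, ⟨_, isLattice_span_pair h⟩, rfl, rfl⟩

theorem linearIndependent_of_isLattice {x y : Fin 2 → F}
    (h : (span 𝒪[F] {x, y}).IsLattice F) : LinearIndependent F ![x, y] := by
  have h1 := h.span_eq_top
  rw [span_span_of_tower] at h1
  refine linearIndependent_of_top_le_span_of_card_eq_finrank ?_ (by simp)
  rw [← h1]
  simp [Matrix.range_cons, Set.pair_comm]

theorem IsClassOf.linearIndependent {v : Vertex F} {x y : Fin 2 → F} (h : IsClassOf v x y) :
    LinearIndependent F ![x, y] := by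
  obtain ⟨Λ, hΛ, rfl⟩ := h
  exact linearIndependent_of_isLattice (hΛ ▸ Λ.2)

theorem eq_of_combination_eq {e f : Fin 2 → F} (h : LinearIndependent F ![e, f])
    {s t s' t' : 𝒪[F]} (heq : s • e + t • f = s' • e + t' • f) : s = s' ∧ t = t' := by
  rw [LinearIndependent.pair_iff] at h
  have := h (s - s') (t - t') (by
    have h2 : ((s - s' : 𝒪[F]) : F) • e + ((t - t' : 𝒪[F]) : F) • f = 0 := by
      simp only [coe_smul]
      rw [sub_smul, sub_smul, ← sub_eq_zero.mpr heq]
      abel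
    simpa using h2)
  exact ⟨Subtype.ext (sub_eq_zero.mp this.1), Subtype.ext (sub_eq_zero.mp this.2)⟩

/-- Relative to a root lattice `M`, the vertex `v` is at distance `n` from the root and is the class
of `⟨e, π ^ n f⟩` where `e, f` is a basis of `M`. -/
structure IsNormalForm (π : 𝒪[F]) (M : Submodule 𝒪[F] (Fin 2 → F)) (v : Vertex F)
    (e f : Fin 2 → F) (n : ℕ) : Prop where
  span_eq : span 𝒪[F] {e, f} = M
  isClassOf : IsClassOf v e (π ^ n • f)

variable {π : 𝒪[F]} {M : Submodule 𝒪[F] (Fin 2 → F)}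

/-- With `Λ = ⟨e, π ^ n f⟩` and `k ≤ n`, the lattice `⟨e, π ^ k f⟩` is `Λ + π ^ k M`, which does not
depend on the basis. -/
theorem span_pow_le {e f e' f' : Fin 2 → F} {n n' k : ℕ} (hM : span 𝒪[F] {e, f} = M)
    (hM' : span 𝒪[F] {e', f'} = M)
    (h : span 𝒪[F] {e, π ^ n • f} = span 𝒪[F] {e', π ^ n' • f'}) (hk : k ≤ n') :
    span 𝒪[F] {e, π ^ k • f} ≤ span 𝒪[F] {e', π ^ k • f'} := by
  have hle : span 𝒪[F] {e', π ^ n' • f'} ≤ span 𝒪[F] {e', π ^ k • f'} := by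
    refine span_pair_le.mpr ⟨subset_span (by simp), ?_⟩
    obtain ⟨m, rfl⟩ := Nat.exists_eq_add_of_le hk
    rw [add_comm, pow_add, mul_smul]
    exact smul_mem _ _ (subset_span (by simp))
  refine span_pair_le.mpr ⟨hle (h ▸ subset_span (by simp)), ?_⟩
  have hf : f ∈ span 𝒪[F] {e', f'} := by rw [hM', ← hM]; exact subset_span (by simp)
  obtain ⟨s, t, rfl⟩ := mem_span_pair.mp hf
  rw [smul_add, smul_comm (π ^ k) s, smul_comm (π ^ k) t]
  refine add_mem (smul_mem _ _ (smul_mem _ _ (subset_span (by simp))))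
    (smul_mem _ _ (subset_span (by simp)))

theorem not_mem_span_of_not_isUnit {e f x y : Fin 2 → F} (hli : LinearIndependent F ![e, f])
    (hx : x ∈ span 𝒪[F] {e, f}) (hy : y ∈ span 𝒪[F] {e, f}) {c : 𝒪[F]} (hc : ¬ IsUnit c) :
    e ∉ span 𝒪[F] {c • x, c • y} := by
  intro h
  obtain ⟨s, t, hst⟩ := mem_span_pair.mp h
  have : s • x + t • y ∈ span 𝒪[F] {e, f} := add_mem (smul_mem _ _ hx) (smul_mem _ _ hy)
  obtain ⟨a, b, hab⟩ := mem_span_pair.mp this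
  have h2 : (c * a) • e + (c * b) • f = (1 : 𝒪[F]) • e + (0 : 𝒪[F]) • f := by
    rw [mul_smul, mul_smul, ← smul_add, hab, ← hst]
    module
  exact hc (IsUnit.of_mul_eq_one a (eq_of_combination_eq hli h2).1)

theorem span_smul_pair_of_isUnit {c : 𝒪[F]} (hc : IsUnit c) (x y : Fin 2 → F) :
    span 𝒪[F] {c • x, c • y} = span 𝒪[F] {x, y} := by
  obtain ⟨u, rfl⟩ := hc
  apply le_antisymm <;> rw [span_pair_le]
  · exact ⟨smul_mem _ _ (subset_span (by simp)), smul_mem _ _ (subset_span (by simp))⟩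
  · constructor
    · convert! smul_mem _ ((u⁻¹ : 𝒪[F]ˣ) : 𝒪[F]) (subset_span
        (show (u : 𝒪[F]) • x ∈ ({(u : 𝒪[F]) • x, (u : 𝒪[F]) • y} : Set (Fin 2 → F)) by simp))
      rw [smul_smul, Units.inv_mul, one_smul]
    · convert! smul_mem _ ((u⁻¹ : 𝒪[F]ˣ) : 𝒪[F]) (subset_span
        (show (u : 𝒪[F]) • y ∈ ({(u : 𝒪[F]) • x, (u : 𝒪[F]) • y} : Set (Fin 2 → F)) by simp))
      rw [smul_smul, Units.inv_mul, one_smul]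

theorem exists_integer_or_inv (c : F) : (∃ t : 𝒪[F], (t : F) = c) ∨ ∃ t : 𝒪[F], (t : F) = c⁻¹ := by
  rcases le_total (ValuativeRel.valuation F c) 1 with h | h
  · exact Or.inl ⟨⟨c, h⟩, rfl⟩
  · refine Or.inr ⟨⟨c⁻¹, ?_⟩, rfl⟩
    change ValuativeRel.valuation F c⁻¹ ≤ 1
    rw [map_inv₀]
    exact inv_le_one_of_one_le₀ h

theorem exists_integer_mul (a b : F) : (∃ t : 𝒪[F], a = t * b) ∨ ∃ t : 𝒪[F], b = t * a := by
  by_cases hb : b = 0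
  · exact Or.inr ⟨0, by simp [hb]⟩
  by_cases ha : a = 0
  · exact Or.inl ⟨0, by simp [ha]⟩
  rcases exists_integer_or_inv (a / b) with ⟨t, ht⟩ | ⟨t, ht⟩
  · exact Or.inl ⟨t, by rw [ht]; field_simp⟩
  · exact Or.inr ⟨t, by rw [ht]; field_simp⟩

namespace IsNormalForm

theorem linearIndependent (hM : M.IsLattice F) {e f : Fin 2 → F} (h : span 𝒪[F] {e, f} = M) :
    LinearIndependent F ![e, f] :=
  linearIndependent_of_isLattice (h ▸ hM)

theorem mem_lattice {v : Vertex F} {e f : Fin 2 → F} {n : ℕ} (h : IsNormalForm π M v e f n) :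
    e ∈ M ∧ π ^ n • f ∈ M := by
  rw [← h.span_eq]
  exact ⟨subset_span (by simp), smul_mem _ _ (subset_span (by simp))⟩

/-- The two lattices differ by a scalar, which or whose inverse is integral. It must be a unit: each
lattice contains a basis vector of `M`, and a non-unit multiple of a sublattice of `M` contains
none. -/
theorem span_eq_span (hM : M.IsLattice F) {v : Vertex F} {e f e' f' : Fin 2 → F} {n n' : ℕ}
    (h : IsNormalForm π M v e f n) (h' : IsNormalForm π M v e' f' n') :
    span 𝒪[F] {e, π ^ n • f} = span 𝒪[F] {e', π ^ n' • f'} := by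
  have key : ∀ {e f e' f' : Fin 2 → F} {n n' : ℕ}, IsNormalForm π M v e f n →
      IsNormalForm π M v e' f' n' → ∀ c : 𝒪[F],
      span 𝒪[F] {c • e, c • (π ^ n • f)} = span 𝒪[F] {e', π ^ n' • f'} →
      span 𝒪[F] {e, π ^ n • f} = span 𝒪[F] {e', π ^ n' • f'} := by
    intro e f e' f' n n' h h' c hc
    by_cases hu : IsUnit c
    · rw [← hc, span_smul_pair_of_isUnit hu]
    · have hin : e' ∈ span 𝒪[F] {c • e, c • (π ^ n • f)} := hc ▸ subset_span (by simp)
      exact absurd hin (not_mem_span_of_not_isUnit (linearIndependent hM h'.span_eq)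
        (h'.span_eq ▸ h.mem_lattice.1) (h'.span_eq ▸ h.mem_lattice.2) hu)
  obtain ⟨c, hc0, hc⟩ := h.isClassOf.exists_scalar h'.isClassOf
  rcases exists_integer_or_inv c with ⟨t, rfl⟩ | ⟨t, ht⟩
  · exact key h h' t hc
  · refine (key h' h t ?_).symm
    rw [← coe_smul, ← coe_smul, ht]
    have h1 := congrArg (Submodule.map (intLin (Matrix.GeneralLinearGroup.scalar (Fin 2)
      (Units.mk0 c hc0)⁻¹))) hc
    rw [map_span_pair, map_span_pair] at h1
    simp only [intLin_scalar, Units.val_inv_eq_inv_val, Units.val_mk0, smul_smul,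
      inv_mul_cancel₀ hc0, one_smul] at h1
    exact h1.symm

/-- The exponent is the least `m` with `π ^ m M` inside the lattice, and the intermediate lattices
are canonical by `span_pow_le`. This makes the geodesic to the root well defined. -/
theorem unique (hπ : Irreducible π) (hM : M.IsLattice F) {v : Vertex F} {e f e' f' : Fin 2 → F}
    {n n' : ℕ} (h : IsNormalForm π M v e f n) (h' : IsNormalForm π M v e' f' n') :
    n = n' ∧ ∀ k ≤ n, span 𝒪[F] {e, π ^ k • f} = span 𝒪[F] {e', π ^ k • f'} := by
  have heq := h.span_eq_span hM h'
  have hle : ∀ {e f e' f' : Fin 2 → F} {n n' : ℕ}, span 𝒪[F] {e, f} = M → span 𝒪[F] {e', f'} = M →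
      span 𝒪[F] {e, π ^ n • f} = span 𝒪[F] {e', π ^ n' • f'} → n ≤ n' := by
    intro e f e' f' n n' hs hs' h
    have h1 : π ^ n' • f ∈ span 𝒪[F] {e, π ^ n • f} := by
      have hf : f ∈ span 𝒪[F] {e', f'} := by rw [hs', ← hs]; exact subset_span (by simp)
      obtain ⟨s, t, hst⟩ := mem_span_pair.mp hf
      rw [h, ← hst, smul_add, smul_comm (π ^ n') s, smul_comm (π ^ n') t]
      exact add_mem (smul_mem _ _ (smul_mem _ _ (subset_span (by simp))))
        (smul_mem _ _ (subset_span (by simp)))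
    obtain ⟨s, t, hst⟩ := mem_span_pair.mp h1
    have h2 : s • e + (t * π ^ n) • f = (0 : 𝒪[F]) • e + π ^ n' • f := by
      rw [mul_smul, hst]; simp
    have h3 := (eq_of_combination_eq (linearIndependent hM hs) h2).2
    have h4 : π ^ n ∣ π ^ n' := ⟨t, by rw [← h3, mul_comm]⟩
    exact (pow_dvd_pow_iff hπ.ne_zero hπ.not_isUnit).mp h4
  have hn : n = n' := le_antisymm (hle h.span_eq h'.span_eq heq) (hle h'.span_eq h.span_eq heq.symm)
  refine ⟨hn, fun k hk => le_antisymm ?_ ?_⟩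
  · exact span_pow_le h.span_eq h'.span_eq heq (hn ▸ hk)
  · exact span_pow_le h'.span_eq h.span_eq heq.symm hk

end IsNormalForm

end RootedTree

/-! ### The parent map, and edges as parent–child pairs. -/

section RootedTree

open Submodule

variable {F : Type*} [Field F] [ValuativeRel F]

theorem span_pair_add_smul (x y : Fin 2 → F) (t : 𝒪[F]) :
    span 𝒪[F] {x, y + t • x} = span 𝒪[F] {x, y} := by
  apply le_antisymm <;> rw [span_pair_le] <;> refine ⟨subset_span (by simp), ?_⟩
  · exact add_mem (subset_span (by simp)) (smul_mem _ _ (subset_span (by simp)))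
  · exact mem_span_pair.mpr ⟨-t, 1, by module⟩

theorem span_pair_smul_of_isUnit (x y : Fin 2 → F) {t : 𝒪[F]} (ht : IsUnit t) :
    span 𝒪[F] {x, t • y} = span 𝒪[F] {x, y} := by
  apply le_antisymm <;> rw [span_pair_le] <;> refine ⟨subset_span (by simp), ?_⟩
  · exact smul_mem _ _ (subset_span (by simp))
  · obtain ⟨s, hs⟩ := ht.exists_left_inv
    exact mem_span_pair.mpr ⟨0, s, by rw [smul_smul, hs]; simp⟩

theorem intLin_injective (g : GL (Fin 2) F) : Function.Injective (intLin g) := by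
  intro x y hxy
  have := congrArg (intLin g⁻¹) hxy
  rwa [← LinearMap.comp_apply, ← LinearMap.comp_apply, ← intLin_mul, inv_mul_cancel,
    intLin_one] at this

theorem rel_smul (g : GL (Fin 2) F) {Λ Λ' : OLattice F} (h1 : 𝓂[F] • Λ.1 < Λ'.1)
    (h2 : Λ'.1 < Λ.1) : 𝓂[F] • (g • Λ).1 < (g • Λ').1 ∧ (g • Λ').1 < (g • Λ).1 := by
  have hmono := map_strictMono_of_injective (f := intLin g) (intLin_injective g)
  simp only [smul_val]
  rw [← map_smul'']
  exact ⟨hmono h1, hmono h2⟩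

variable {π : 𝒪[F]} {b₁ b₂ : Fin 2 → F}

open Classical in
/-- The neighbour of `v` on the geodesic from `v` to the root `M`. -/
noncomputable def parent (π : 𝒪[F]) (M : Submodule 𝒪[F] (Fin 2 → F)) (v : Vertex F) : Vertex F :=
  -- The truncated `n - 1` makes the root its own parent. Over a discrete valuation ring the default
  -- value is never taken when `M` is a lattice spanned by a basis, by `exists_normalForm`.
  if h : ∃ w e f n, IsNormalForm π M v e f n ∧ IsClassOf w e (π ^ (n - 1) • f) then h.choose else v

variable {M : Submodule 𝒪[F] (Fin 2 → F)}

theorem parent_eq (hπ : Irreducible π) (hM : M.IsLattice F) {v w : Vertex F} {e f : Fin 2 → F}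
    {n : ℕ} (h : IsNormalForm π M v e f n) (hw : IsClassOf w e (π ^ (n - 1) • f)) :
    parent π M v = w := by
  have hex : ∃ w e f n, IsNormalForm π M v e f n ∧ IsClassOf w e (π ^ (n - 1) • f) :=
    ⟨w, e, f, n, h, hw⟩
  rw [parent, dif_pos hex]
  obtain ⟨e', f', n', h', hw'⟩ := hex.choose_spec
  obtain ⟨hn, hspan⟩ := h.unique hπ hM h'
  subst hn
  exact hw'.unique hw (hspan (n - 1) (Nat.sub_le n 1)).symm

theorem IsNormalForm.exists_lower (hπ : Irreducible π) (hM : M.IsLattice F) {v : Vertex F}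
    {e f : Fin 2 → F} {n : ℕ} (h : IsNormalForm π M v e f n) (k : ℕ) :
    ∃ w, IsClassOf w e (π ^ k • f) := by
  refine exists_isClassOf ?_
  have hli := IsNormalForm.linearIndependent hM h.span_eq
  rw [LinearIndependent.pair_iff] at hli ⊢
  intro s t hst
  rw [← coe_smul, smul_smul] at hst
  have := hli _ _ hst
  exact ⟨this.1, by simpa [hπ.ne_zero] using this.2⟩

theorem IsNormalForm.iterate_parent (hπ : Irreducible π) (hM : M.IsLattice F) {e f : Fin 2 → F}
    {n k : ℕ} : ∀ {v : Vertex F}, IsNormalForm π M v e f n →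
      IsNormalForm π M ((parent π M)^[k] v) e f (n - k) := by
  induction k with
  | zero => exact fun h => h
  | succ k ih =>
    intro v h
    rw [Function.iterate_succ_apply']
    obtain ⟨w, hw⟩ := (ih h).exists_lower hπ hM (n - k - 1)
    rw [parent_eq hπ hM (ih h) hw]
    exact ⟨h.span_eq, by rwa [← Nat.sub_sub]⟩

theorem parent_root (hπ : Irreducible π) (hb : LinearIndependent F ![b₁, b₂])
    {o : Vertex F} (ho : IsClassOf o b₁ b₂) : parent π (span 𝒪[F] {b₁, b₂}) o = o :=
  parent_eq hπ (isLattice_span_pair hb) (n := 0) ⟨rfl, by simpa using ho⟩ (by simpa using ho)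

variable [IsDiscreteValuationRing 𝒪[F]]

theorem exists_span_pair {Λ : Submodule 𝒪[F] (Fin 2 → F)} (hΛ : Λ.IsLattice F) :
    ∃ x y, Λ = span 𝒪[F] {x, y} := by
  have : Module.Free 𝒪[F] Λ := IsLattice.free (K := F) Λ
  have hr : Module.finrank 𝒪[F] Λ = 2 := by
    simpa using IsLattice.finrank_of_pi F Λ
  let b := Module.finBasisOfFinrankEq 𝒪[F] Λ hr
  refine ⟨b 0, b 1, ?_⟩
  have h := congrArg (Submodule.map Λ.subtype) b.span_eq
  rw [map_span, Submodule.map_top, range_subtype, ← Set.range_comp] at h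
  refine h.symm.trans ?_
  congr 1
  ext x
  simp [eq_comm]

/-- One of the two `b₂`-coordinates of a lattice basis divides the other over the valuation ring, so
one step of elimination triangularizes the basis. -/
theorem exists_hermite {Λ : Submodule 𝒪[F] (Fin 2 → F)} (hΛ : Λ.IsLattice F) {b₁ b₂ : Fin 2 → F}
    (hb : LinearIndependent F ![b₁, b₂]) :
    ∃ a b c : F, a ≠ 0 ∧ c ≠ 0 ∧ Λ = span 𝒪[F] {a • b₁, b • b₁ + c • b₂} := by
  obtain ⟨a, b, c, h⟩ : ∃ a b c : F, Λ = span 𝒪[F] {a • b₁, b • b₁ + c • b₂} := by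
    obtain ⟨x, y, hxy⟩ := exists_span_pair hΛ
    have hspan : ∀ z : Fin 2 → F, ∃ s t : F, s • b₁ + t • b₂ = z := by
      intro z
      have h1 : z ∈ span F {b₁, b₂} := by
        have := hb.span_eq_top_of_card_eq_finrank (by simp)
        simp only [Matrix.range_cons, Matrix.range_empty, Set.union_empty,
          Set.singleton_union] at this
        rw [this]; trivial
      exact mem_span_pair.mp h1
    obtain ⟨x₁, x₂, rfl⟩ := hspan x
    obtain ⟨y₁, y₂, rfl⟩ := hspan y
    rcases exists_integer_mul x₂ y₂ with ⟨t, ht⟩ | ⟨t, ht⟩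
    · refine ⟨x₁ - t * y₁, y₁, y₂, ?_⟩
      rw [hxy, Set.pair_comm, Set.pair_comm _ (y₁ • b₁ + y₂ • b₂),
        ← span_pair_add_smul _ (x₁ • b₁ + x₂ • b₂) (-t), ht]
      congr 3
      rw [neg_smul, ← coe_smul]
      module
    · refine ⟨y₁ - t * x₁, x₁, x₂, ?_⟩
      rw [hxy, Set.pair_comm _ (x₁ • b₁ + x₂ • b₂),
        ← span_pair_add_smul _ (y₁ • b₁ + y₂ • b₂) (-t), ht]
      congr 3
      rw [neg_smul, ← coe_smul]
      module
  have hli := linearIndependent_of_isLattice (h ▸ hΛ)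
  rw [LinearIndependent.pair_iff] at hli
  refine ⟨a, b, c, ?_, ?_, h⟩
  · rintro rfl
    simpa using hli 1 0 (by simp)
  · rintro rfl
    have := hli b (-a) (by module)
    have ha : a = 0 := by simpa using this.2
    subst ha
    simpa using hli 1 0 (by simp)

theorem exists_normalForm_of_isClassOf (hπ : Irreducible π) {v : Vertex F} {e f : Fin 2 → F}
    {t : 𝒪[F]} (h : IsClassOf v e (t • f)) :
    ∃ n, IsNormalForm π (span 𝒪[F] {e, f}) v e f n := by
  have ht : t ≠ 0 := by
    rintro rfl
    have := h.linearIndependent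
    rw [LinearIndependent.pair_iff] at this
    simpa using this 0 1 (by simp)
  obtain ⟨n, u, hu⟩ := IsDiscreteValuationRing.associated_pow_irreducible ht hπ
  refine ⟨n, rfl, h.congr ?_⟩
  rw [← hu, mul_comm, mul_smul, span_pair_smul_of_isUnit _ _ u.isUnit]

theorem exists_normalForm (hπ : Irreducible π) (hb : LinearIndependent F ![b₁, b₂])
    (v : Vertex F) : ∃ e f n, IsNormalForm π (span 𝒪[F] {b₁, b₂}) v e f n := by
  obtain ⟨Λ, rfl⟩ : ∃ Λ : OLattice F, Λ.cls = v := Quotient.exists_rep v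
  obtain ⟨a, b, c, ha, hc, hΛ⟩ := exists_hermite Λ.2 hb
  have hcls : IsClassOf Λ.cls (a • b₁) (b • b₁ + c • b₂) := ⟨Λ, hΛ, rfl⟩
  -- The cases are distinguished by which of `a`, `b`, `c` divides the other two. Dividing by it
  -- leaves a basis vector of the root lattice as pivot, and elimination puts the other generator
  -- into the form `t • f`.
  have case1 : ∀ s t : 𝒪[F], b = s * a → c = t * a →
      ∃ e f n, IsNormalForm π (span 𝒪[F] {b₁, b₂}) Λ.cls e f n := by
    intro s t hs ht
    have h1 : IsClassOf Λ.cls b₁ (t • b₂ + s • b₁) := by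
      rw [← isClassOf_iff ha]
      convert hcls using 1
      rw [hs, ht, ← coe_smul, ← coe_smul]
      module
    obtain ⟨n, hn⟩ := exists_normalForm_of_isClassOf hπ (h1.congr (span_pair_add_smul _ _ _))
    exact ⟨_, _, n, hn⟩
  have case2 : ∀ s t : 𝒪[F], a = s * b → c = t * b →
      ∃ e f n, IsNormalForm π (span 𝒪[F] {b₁, b₂}) Λ.cls e f n := by
    intro s t hs ht
    have hb0 : b ≠ 0 := by
      rintro rfl
      exact ha (by simpa using hs)
    have h1 : IsClassOf Λ.cls (s • b₁) (b₁ + t • b₂) := by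
      rw [← isClassOf_iff hb0]
      convert hcls using 1
      · rw [hs, ← coe_smul]; module
      · rw [ht, ← coe_smul]; module
    have h2 : IsClassOf Λ.cls (b₁ + t • b₂) ((-(s * t)) • b₂) := by
      refine h1.congr ?_
      rw [Set.pair_comm, ← span_pair_add_smul _ _ (-s)]
      congr 3
      module
    obtain ⟨n, hn⟩ := exists_normalForm_of_isClassOf hπ h2
    rw [Set.pair_comm, span_pair_add_smul, Set.pair_comm] at hn
    exact ⟨_, _, n, hn⟩
  have case3 : ∀ s t : 𝒪[F], a = s * c → b = t * c →
      ∃ e f n, IsNormalForm π (span 𝒪[F] {b₁, b₂}) Λ.cls e f n := by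
    intro s t hs ht
    have h1 : IsClassOf Λ.cls (s • b₁) (b₂ + t • b₁) := by
      rw [← isClassOf_iff hc]
      convert hcls using 1
      · rw [hs, ← coe_smul]; module
      · rw [ht, ← coe_smul]; module
    rw [IsClassOf] at h1
    rw [Set.pair_comm] at h1
    obtain ⟨n, hn⟩ := exists_normalForm_of_isClassOf hπ h1
    rw [Set.pair_comm, span_pair_add_smul] at hn
    exact ⟨_, _, n, hn⟩
  rcases exists_integer_mul a b with ⟨s, hs⟩ | ⟨s, hs⟩
  · rcases exists_integer_mul b c with ⟨t, ht⟩ | ⟨t, ht⟩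
    · exact case3 (s * t) t (by rw [hs, ht]; push_cast; ring) ht
    · exact case2 s t hs ht
  · rcases exists_integer_mul a c with ⟨t, ht⟩ | ⟨t, ht⟩
    · exact case3 t (s * t) ht (by rw [hs, ht]; push_cast; ring)
    · exact case1 s t hs ht

theorem exists_iterate_parent_eq (hπ : Irreducible π) (hb : LinearIndependent F ![b₁, b₂])
    {o : Vertex F} (ho : IsClassOf o b₁ b₂) (v : Vertex F) :
    ∃ n, (parent π (span 𝒪[F] {b₁, b₂}))^[n] v = o := by
  obtain ⟨e, f, n, h⟩ := exists_normalForm hπ hb v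
  have h2 := h.iterate_parent hπ (isLattice_span_pair hb) (k := n)
  refine ⟨n, h2.isClassOf.unique ho ?_⟩
  rw [Nat.sub_self, pow_zero, one_smul, h.span_eq]

theorem eq_span_of_mem (hπ : Irreducible π) {e g : Fin 2 → F} {N : Submodule 𝒪[F] (Fin 2 → F)}
    (h1 : π • span 𝒪[F] {e, g} ≤ N) (h2 : N < span 𝒪[F] {e, g}) (he : e ∈ N) :
    N = span 𝒪[F] {e, π • g} := by
  apply le_antisymm
  · intro y hy
    obtain ⟨s, t, rfl⟩ := mem_span_pair.mp (h2.le hy)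
    have htg : t • g ∈ N := by
      have := sub_mem hy (smul_mem N s he)
      rwa [add_sub_cancel_left] at this
    have ht : ¬ IsUnit t := by
      intro ht
      refine h2.not_ge (span_pair_le.mpr ⟨he, ?_⟩)
      obtain ⟨r, hr⟩ := ht.exists_left_inv
      simpa [smul_smul, hr] using smul_mem N r htg
    have hdvd : π ∣ t := by
      have : t ∈ IsLocalRing.maximalIdeal 𝒪[F] := ht
      rwa [hπ.maximalIdeal_eq, Ideal.mem_span_singleton] at this
    obtain ⟨r, rfl⟩ := hdvd
    exact mem_span_pair.mpr ⟨s, r, by module⟩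
  · refine span_pair_le.mpr ⟨he, h1 ?_⟩
    exact smul_mem_pointwise_smul _ _ _ (subset_span (by simp))

/-- Scale so that `Λ = ⟨e, π ^ n f⟩`, and take `x = α e + β π ^ n f` in the scaled `Λ'` but outside
`πΛ`. If `α` is a unit, `e` can be corrected to lie in the scaled `Λ'`, which is then a child of
`Λ`. Otherwise `β` is a unit, and the scaled `Λ'` is `⟨π e, π ^ n f⟩`, whose class is the parent
when `n > 0`. -/
theorem parent_of_rel (hπ : Irreducible π) (hb : LinearIndependent F ![b₁, b₂])
    {Λ Λ' : OLattice F} (h1 : 𝓂[F] • Λ.1 < Λ'.1) (h2 : Λ'.1 < Λ.1) :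
    Λ'.cls = parent π (span 𝒪[F] {b₁, b₂}) Λ.cls ∨
      Λ.cls = parent π (span 𝒪[F] {b₁, b₂}) Λ'.cls := by
  have hM := isLattice_span_pair hb
  obtain ⟨e, f, n, h⟩ := exists_normalForm hπ hb Λ.cls
  obtain ⟨Λ₁, hΛ₁, hcls⟩ := h.isClassOf
  obtain ⟨c, hc⟩ := Quotient.exact hcls.symm
  have hcls' : (Matrix.GeneralLinearGroup.scalar (Fin 2) c • Λ').cls = Λ'.cls :=
    (Quotient.sound ⟨c, rfl⟩ : Λ'.cls = OLattice.cls _).symm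
  obtain ⟨h1, h2⟩ := rel_smul (Matrix.GeneralLinearGroup.scalar (Fin 2) c) h1 h2
  rw [hc, hΛ₁] at h1 h2
  rw [← hcls']
  set Λ₂ := Matrix.GeneralLinearGroup.scalar (Fin 2) c • Λ'
  rw [hπ.maximalIdeal_eq, ideal_span_singleton_smul] at h1
  obtain ⟨x, hx, hx'⟩ := SetLike.exists_of_lt h1
  obtain ⟨α, β, rfl⟩ := mem_span_pair.mp (h2.le hx)
  by_cases hα : IsUnit α
  · obtain ⟨u, hu⟩ := hα.exists_left_inv
    have hx2 : e + (u * β * π ^ n) • f ∈ Λ₂.1 := by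
      convert smul_mem Λ₂.1 u hx using 1
      rw [smul_add, smul_smul, hu]
      module
    have hs : span 𝒪[F] {e + (u * β * π ^ n) • f, π ^ n • f} = span 𝒪[F] {e, π ^ n • f} := by
      rw [Set.pair_comm, mul_smul, span_pair_add_smul, Set.pair_comm]
    rw [← hs] at h1 h2
    have h3 := eq_span_of_mem hπ h1.le h2 hx2
    right
    refine (parent_eq hπ hM (e := e + (u * β * π ^ n) • f) (f := f) (n := n + 1) ⟨?_, ?_⟩ ?_).symm
    · rw [Set.pair_comm, span_pair_add_smul, Set.pair_comm, h.span_eq]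
    · exact ⟨Λ₂, by rw [h3, pow_succ', mul_smul π], rfl⟩
    · exact h.isClassOf.congr hs.symm
  · have hα' : π ∣ α := by
      have : α ∈ IsLocalRing.maximalIdeal 𝒪[F] := hα
      rwa [hπ.maximalIdeal_eq, Ideal.mem_span_singleton] at this
    obtain ⟨α, rfl⟩ := hα'
    have hβ : IsUnit β := by
      by_contra hβ
      have hβ' : π ∣ β := by
        have : β ∈ IsLocalRing.maximalIdeal 𝒪[F] := hβ
        rwa [hπ.maximalIdeal_eq, Ideal.mem_span_singleton] at this
      obtain ⟨β, rfl⟩ := hβ'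
      refine hx' ?_
      convert smul_mem_pointwise_smul (α • e + β • π ^ n • f) π _
        (mem_span_pair.mpr ⟨α, β, rfl⟩) using 1
      module
    obtain ⟨u, hu⟩ := hβ.exists_left_inv
    have hg : π ^ n • f ∈ Λ₂.1 := by
      have h4 : (π * α) • e ∈ Λ₂.1 := by
        rw [mul_smul]
        exact h1.le (smul_mem_pointwise_smul _ _ _ (smul_mem _ _ (subset_span (by simp))))
      have h5 := smul_mem Λ₂.1 u (sub_mem hx h4)
      rwa [add_sub_cancel_left, smul_smul, hu, one_smul] at h5
    rw [Set.pair_comm] at h1 h2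
    have h3 := eq_span_of_mem hπ h1.le h2 hg
    -- At the root there is no parent to reach: `e` and `f` exchange roles and `Λ'` is again a
    -- child.
    rcases Nat.eq_zero_or_pos n with rfl | hn
    · right
      refine (parent_eq hπ hM (e := f) (f := e) (n := 1) ⟨?_, ?_⟩ ?_).symm
      · rw [Set.pair_comm, h.span_eq]
      · exact ⟨Λ₂, by rw [h3]; simp, rfl⟩
      · refine h.isClassOf.congr ?_
        rw [Set.pair_comm]
        simp
    · left
      refine (parent_eq hπ hM h ?_).symm
      have hπ0 : (π : F) ≠ 0 := fun h => hπ.ne_zero (Subtype.ext h)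
      rw [← isClassOf_iff hπ0]
      refine ⟨Λ₂, ?_, rfl⟩
      rw [h3, Set.pair_comm, coe_smul, coe_smul, smul_smul, ← pow_succ', Nat.sub_add_cancel hn]

theorem parent_of_adj (hπ : Irreducible π) (hb : LinearIndependent F ![b₁, b₂])
    {v w : Vertex F} (h : (bruhatTits F).Adj v w) :
    w = parent π (span 𝒪[F] {b₁, b₂}) v ∨ v = parent π (span 𝒪[F] {b₁, b₂}) w := by
  rw [bruhatTits, SimpleGraph.fromRel_adj] at h
  rcases h.2 with ⟨Λ, Λ', rfl, rfl, h1, h2⟩ | ⟨Λ, Λ', rfl, rfl, h1, h2⟩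
  · exact parent_of_rel hπ hb h1 h2
  · exact (parent_of_rel hπ hb h1 h2).symm

theorem adj_parent (hπ : Irreducible π) (hb : LinearIndependent F ![b₁, b₂])
    {o v : Vertex F} (ho : IsClassOf o b₁ b₂) (hv : v ≠ o) :
    (bruhatTits F).Adj v (parent π (span 𝒪[F] {b₁, b₂}) v) := by
  have hM := isLattice_span_pair hb
  obtain ⟨e, f, n, h⟩ := exists_normalForm hπ hb v
  obtain ⟨m, rfl⟩ : ∃ m, n = m + 1 := by
    refine Nat.exists_eq_succ_of_ne_zero ?_
    rintro rfl
    exact hv (h.isClassOf.unique ho (by rw [pow_zero, one_smul, h.span_eq]))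
  obtain ⟨w, hw⟩ := h.exists_lower hπ hM m
  rw [parent_eq hπ hM h hw]
  have hwn : IsNormalForm π (span 𝒪[F] {b₁, b₂}) w e f m := ⟨h.span_eq, hw⟩
  have hne : v ≠ w := by
    rintro rfl
    exact absurd (h.unique hπ hM hwn).1 (by simp)
  rw [bruhatTits, SimpleGraph.fromRel_adj]
  refine ⟨hne, Or.inr ?_⟩
  obtain ⟨Λ, hΛ, hΛw⟩ := hw
  obtain ⟨Λ', hΛ', hΛv⟩ := h.isClassOf
  refine ⟨Λ, Λ', hΛw, hΛv, lt_of_le_of_ne ?_ ?_, lt_of_le_of_ne ?_ ?_⟩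
  · rw [hπ.maximalIdeal_eq, ideal_span_singleton_smul, hΛ, hΛ']
    rintro _ ⟨y, hy, rfl⟩
    obtain ⟨s, t, rfl⟩ := mem_span_pair.mp hy
    refine mem_span_pair.mpr ⟨π * s, t, ?_⟩
    change _ = π • (s • e + t • π ^ m • f)
    rw [pow_succ]
    module
  · intro heq
    have he : e ∈ span 𝒪[F] {π • e, π • (π ^ m • f)} := by
      have h4 : e ∈ 𝓂[F] • Λ.1 := by rw [heq, hΛ']; exact subset_span (by simp)
      rw [hπ.maximalIdeal_eq, ideal_span_singleton_smul, hΛ] at h4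
      obtain ⟨y, hy, hye⟩ := h4
      obtain ⟨s, t, rfl⟩ := mem_span_pair.mp hy
      refine mem_span_pair.mpr ⟨s, t, Eq.trans ?_ hye⟩
      change _ = π • (s • e + t • π ^ m • f)
      module
    refine not_mem_span_of_not_isUnit (IsNormalForm.linearIndependent hM h.span_eq)
      (subset_span (by simp)) (smul_mem _ _ (subset_span (by simp))) hπ.not_isUnit he
  · rw [hΛ, hΛ', span_pair_le]
    refine ⟨subset_span (by simp), ?_⟩
    rw [pow_succ', mul_smul]
    exact smul_mem _ _ (subset_span (by simp))
  · intro heq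
    refine hne ?_
    rw [← hΛw, ← hΛv]
    exact congrArg OLattice.cls (Subtype.ext heq)

end RootedTree

/-! ### The minimal subtree and its contraction to a root. -/

section Hull

open Submodule

variable {F : Type*} [Field F] [ValuativeRel F]

theorem pair_mem_treeSimplices_empty {x y : Option (Vertex F)} :
    {x, y} ∈ treeSimplices (∅ : Set (ProjLine F)) ↔ x = none ∧ y = none := by
  simp only [treeSimplices, Set.mem_ofPred_eq, Set.not_nonempty_empty, false_and, or_false, true_and]
  constructor
  · intro h
    exact ⟨by simpa using h.subset (show x ∈ ({x, y} : Set _) by simp),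
      by simpa using h.subset (show y ∈ ({x, y} : Set _) by simp)⟩
  · rintro ⟨rfl, rfl⟩
    simp

/-- Since `x = y` is allowed, membership of `{x, y}` encodes "equal or adjacent", and membership of
`{x, x}` encodes being a vertex. One predicate thus serves for both. -/
theorem pair_mem_treeSimplices {L : Set (ProjLine F)} (hL : L.Nonempty) {x y : Option (Vertex F)} :
    {x, y} ∈ treeSimplices L ↔ ∃ v w, x = some v ∧ y = some w ∧ v ∈ (hull L).verts ∧
      (v = w ∨ (hull L).Adj v w) := by
  simp only [treeSimplices, Set.mem_ofPred_eq, hL, hL.ne_empty, false_and, false_or, true_and]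
  constructor
  · rintro (⟨v, hv, h⟩ | ⟨v, w, hvw, h⟩)
    · have hx : x = some v := by simpa using h.subset (show x ∈ ({x, y} : Set _) by simp)
      have hy : y = some v := by simpa using h.subset (show y ∈ ({x, y} : Set _) by simp)
      exact ⟨v, v, hx, hy, hv, Or.inl rfl⟩
    · rcases Set.pair_eq_pair_iff.mp h with ⟨rfl, rfl⟩ | ⟨rfl, rfl⟩
      · exact ⟨v, w, rfl, rfl, (hull L).edge_vert hvw, Or.inr hvw⟩
      · exact ⟨w, v, rfl, rfl, (hull L).edge_vert hvw.symm, Or.inr hvw.symm⟩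
  · rintro ⟨v, w, rfl, rfl, hv, rfl | hvw⟩
    · exact Or.inl ⟨v, hv, by simp⟩
    · exact Or.inr ⟨v, w, hvw, rfl⟩

variable [IsDiscreteValuationRing 𝒪[F]] {π : 𝒪[F]} {b₁ b₂ : Fin 2 → F}

theorem exists_pow_mul_eq (hπ : Irreducible π) (z : F) : ∃ k : ℕ, ∃ t : 𝒪[F], (π : F) ^ k * z = t := by
  rcases exists_integer_or_inv z with ⟨t, ht⟩ | ⟨t, ht⟩
  · exact ⟨0, t, by simp [ht]⟩
  by_cases hz : z = 0
  · exact ⟨0, 0, by simp [hz]⟩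
  have ht0 : t ≠ 0 := by
    rintro rfl
    exact hz (by simpa using ht.symm)
  obtain ⟨n, u, hu⟩ := IsDiscreteValuationRing.associated_pow_irreducible ht0 hπ
  refine ⟨n, u, ?_⟩
  have h1 := congrArg (Subtype.val) hu
  push_cast at h1
  rw [← h1, ht]
  field_simp

/-- A half-line to the end spanned by `b₁` eventually consists of the classes of the lattices
`⟨b₁, π ^ N b₂⟩`. -/
theorem IsHalfLine.exists_isClassOf (hπ : Irreducible π) (hb : LinearIndependent F ![b₁, b₂])
    {r : ℕ → OLattice F} {ℓ : ProjLine F} (hr : IsHalfLine r ℓ) (hℓ : ℓ.submodule = span F {b₁}) :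
    ∃ n N, IsClassOf (r n).cls b₁ (π ^ (N + 1) • b₂) := by
  obtain ⟨a, b, c, ha, hc, hΛ⟩ := exists_hermite (r 0).2 hb
  have hinf : (r 0).1 ⊓ ℓ.submodule.restrictScalars 𝒪[F] = span 𝒪[F] {a • b₁} := by
    rw [hΛ, hℓ]
    apply le_antisymm
    · rintro x ⟨hx1, hx2⟩
      obtain ⟨s, t, rfl⟩ := mem_span_pair.mp hx1
      obtain ⟨z, hz⟩ := mem_span_singleton.mp hx2
      have h0 := (LinearIndependent.pair_iff.mp hb) (s * a + t * b - z) (t * c) (by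
        rw [sub_smul, hz, ← coe_smul, ← coe_smul]
        module)
      have ht : t = 0 := by
        rcases mul_eq_zero.mp h0.2 with h | h
        · exact Subtype.ext h
        · exact absurd h hc
      rw [ht, zero_smul, add_zero]
      exact smul_mem _ _ (mem_span_singleton_self _)
    · rw [span_singleton_le_iff_mem]
      exact ⟨subset_span (by simp), smul_mem _ _ (mem_span_singleton_self _)⟩
  obtain ⟨k₁, t₁, h₁⟩ := exists_pow_mul_eq hπ (b / a)
  obtain ⟨k₂, t₂, h₂⟩ := exists_pow_mul_eq hπ (c / a)
  have hπ0 : (π : F) ≠ 0 := fun h => hπ.ne_zero (Subtype.ext h)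
  have ht₂ : t₂ ≠ 0 := by
    rintro rfl
    have : (π : F) ^ k₂ * (c / a) ≠ 0 := by positivity
    exact this (by simpa using h₂)
  obtain ⟨m, u, hu⟩ := IsDiscreteValuationRing.associated_pow_irreducible ht₂ hπ
  -- The powers `k₁`, `k₂` clear the denominators of `b / a` and `c / a`. The extra `1` puts the
  -- resulting vertex strictly away from the root `⟨b₁, b₂⟩`.
  set n := k₁ + k₂ + 1 with hn
  have hb' : (π : F) ^ n * b = a * ((π ^ (k₂ + 1) * t₁ : 𝒪[F]) : F) := by
    push_cast
    rw [← h₁, hn]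
    field_simp
    ring
  have hc' : (π : F) ^ n * c = a * ((π ^ (k₁ + 1) * t₂ : 𝒪[F]) : F) := by
    push_cast
    rw [← h₂, hn]
    field_simp
    ring
  refine ⟨n, m + k₁, ?_⟩
  have hrn : (r n).1 = span 𝒪[F] {a • b₁, π ^ n • (b • b₁ + c • b₂)} := by
    rw [hr n, hinf, hπ.maximalIdeal_eq, Ideal.span_singleton_pow, ideal_span_singleton_smul, hΛ]
    apply le_antisymm
    · refine sup_le ?_ ?_
      · rw [span_singleton_le_iff_mem]
        exact subset_span (by simp)
      · rintro _ ⟨y, hy, rfl⟩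
        obtain ⟨s, t, rfl⟩ := mem_span_pair.mp hy
        refine mem_span_pair.mpr ⟨π ^ n * s, t, ?_⟩
        change _ = π ^ n • (s • a • b₁ + t • (b • b₁ + c • b₂))
        module
    · refine span_pair_le.mpr ⟨mem_sup_left (mem_span_singleton_self _), mem_sup_right ?_⟩
      exact smul_mem_pointwise_smul _ _ _ (subset_span (by simp))
  have h3 : IsClassOf (r n).cls (a • b₁)
      (a • ((π ^ (k₁ + 1) * t₂) • b₂ + (π ^ (k₂ + 1) * t₁) • b₁)) := by
    refine ⟨r n, hrn.trans ?_, rfl⟩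
    congr 2
    rw [← coe_smul, ← coe_smul (π ^ (k₁ + 1) * t₂), ← coe_smul (π ^ (k₂ + 1) * t₁), smul_add,
      smul_add, smul_smul, smul_smul, smul_smul, smul_smul, ← hb', ← hc', add_comm]
    push_cast
    rfl
  rw [isClassOf_iff ha] at h3
  refine h3.congr ?_
  rw [span_pair_add_smul, ← span_pair_smul_of_isUnit _ _ u.isUnit, smul_smul,
    show (u : 𝒪[F]) * (π ^ (k₁ + 1) * t₂) = π ^ (m + k₁ + 1) by
      rw [add_assoc, pow_add _ m, ← hu]; ring]

variable {o : Vertex F} {T : (bruhatTits F).Subgraph}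

/-- The edge from `x` to its parent is the only one leaving the set of descendants of `x`, so a
connected `T` meeting both sides contains it. -/
theorem subgraph_adj_parent (hπ : Irreducible π) (hb : LinearIndependent F ![b₁, b₂])
    (hT : T.Connected) {x u u' : Vertex F} (hu : u ∈ T.verts) (hu' : u' ∈ T.verts)
    (hx : ∃ k, (parent π (span 𝒪[F] {b₁, b₂}))^[k] u = x)
    (hx' : ¬ ∃ k, (parent π (span 𝒪[F] {b₁, b₂}))^[k] u' = x) :
    T.Adj x (parent π (span 𝒪[F] {b₁, b₂}) x) := by
  by_contra hadj
  have step : ∀ w w', T.Adj w w' → (∃ k, (parent π (span 𝒪[F] {b₁, b₂}))^[k] w = x) →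
      ∃ k, (parent π (span 𝒪[F] {b₁, b₂}))^[k] w' = x := by
    rintro w w' hww ⟨k, hk⟩
    rcases parent_of_adj hπ hb (T.adj_sub hww) with h | h
    · cases k with
      | zero =>
        refine absurd ?_ hadj
        simp only [Function.iterate_zero, id_eq] at hk
        rw [← hk, ← h]
        exact hww
      | succ k => exact ⟨k, by rw [h]; simpa using hk⟩
    · exact ⟨k + 1, by rw [Function.iterate_succ_apply, ← h, hk]⟩
  have hreach : T.coe.Reachable ⟨u, hu⟩ ⟨u', hu'⟩ := hT.preconnected _ _
  rw [SimpleGraph.reachable_iff_reflTransGen] at hreach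
  refine hx' ?_
  have : ∀ z : T.verts, Relation.ReflTransGen T.coe.Adj ⟨u, hu⟩ z →
      ∃ k, (parent π (span 𝒪[F] {b₁, b₂}))^[k] z.1 = x := by
    intro z hz
    induction hz with
    | refl => exact hx
    | tail _ hab ih => exact step _ _ hab ih
  exact this _ hreach

/-- A subtree with the ends spanned by `b₁` and `b₂` contains the class of `⟨b₁, b₂⟩`. -/
theorem root_mem_of_ends (hπ : Irreducible π) (hb : LinearIndependent F ![b₁, b₂])
    (ho : IsClassOf o b₁ b₂) (hT : T.Connected) {ℓ₁ ℓ₂ : ProjLine F}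
    (h₁ : ℓ₁.submodule = span F {b₁}) (h₂ : ℓ₂.submodule = span F {b₂})
    (hℓ₁ : ℓ₁ ∈ ends T) (hℓ₂ : ℓ₂ ∈ ends T) : o ∈ T.verts := by
  have hM := isLattice_span_pair hb
  obtain ⟨r, hr, hrT⟩ := hℓ₁
  obtain ⟨r', hr', hrT'⟩ := hℓ₂
  obtain ⟨n, N, hn⟩ := hr.exists_isClassOf hπ hb h₁
  obtain ⟨n', N', hn'⟩ := hr'.exists_isClassOf hπ (b₂ := b₁)
    (LinearIndependent.pair_symm_iff.mp hb) h₂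
  have hnf : IsNormalForm π (span 𝒪[F] {b₁, b₂}) (r n).cls b₁ b₂ (N + 1) := ⟨rfl, hn⟩
  have hnf' : IsNormalForm π (span 𝒪[F] {b₁, b₂}) (r' n').cls b₂ b₁ (N' + 1) :=
    ⟨by rw [Set.pair_comm], hn'⟩
  -- `x` is the neighbour of `o` towards `b₁`. The half-line to `b₁` reaches descendants of `x`. The
  -- one to `b₂` reaches a vertex that is not a descendant, as `b₁ ∉ ⟨b₂, π b₁⟩`. Hence the edge
  -- from `x` to `o` lies in `T`.
  obtain ⟨x, hx⟩ := hnf.exists_lower hπ hM 1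
  have hxnf : IsNormalForm π (span 𝒪[F] {b₁, b₂}) x b₁ b₂ 1 := ⟨rfl, hx⟩
  have hadj := subgraph_adj_parent hπ hb hT (x := x) (T.edge_vert (hrT n)) (T.edge_vert (hrT' n'))
    ⟨N, (hnf.iterate_parent hπ hM (k := N)).isClassOf.unique hx (by simp)⟩ (by
      rintro ⟨k, rfl⟩
      obtain ⟨h1, h2⟩ := hxnf.unique hπ hM (hnf'.iterate_parent hπ hM (k := k))
      have hmem : b₁ ∈ span 𝒪[F] {b₂, π ^ 1 • b₁} := h2 1 le_rfl ▸ subset_span (by simp)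
      obtain ⟨s, t, hst⟩ := mem_span_pair.mp hmem
      have h3 : (t * π) • b₁ + s • b₂ = (1 : 𝒪[F]) • b₁ + (0 : 𝒪[F]) • b₂ := by
        rw [one_smul, zero_smul, add_zero]
        refine Eq.trans ?_ hst
        module
      exact hπ.not_isUnit (IsUnit.of_mul_eq_one t
        (by rw [mul_comm]; exact (eq_of_combination_eq hb h3).1)))
  rw [parent_eq hπ hM hxnf (w := o) (by simpa using ho)] at hadj
  exact T.edge_vert hadj.symm

theorem subgraph_adj_parent_of_ne (hπ : Irreducible π) (hb : LinearIndependent F ![b₁, b₂])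
    (ho : IsClassOf o b₁ b₂) (hT : T.Connected) (hoT : o ∈ T.verts) {v : Vertex F}
    (hv : v ∈ T.verts) (hvo : v ≠ o) : T.Adj v (parent π (span 𝒪[F] {b₁, b₂}) v) := by
  refine subgraph_adj_parent hπ hb hT hv hoT ⟨0, rfl⟩ ?_
  rintro ⟨k, hk⟩
  rw [Function.iterate_fixed (parent_root hπ hb ho)] at hk
  exact hvo hk.symm

/-- The tree attached to a set of ends which is not a single point is contracted to a vertex by a
map which moves each vertex to a neighbour. -/
theorem exists_treeContraction (L : Set (ProjLine F)) (hL : L.encard ≠ 1) :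
    ∃ (o : Option (Vertex F)) (r : Option (Vertex F) → Option (Vertex F)),
      {o, o} ∈ treeSimplices L ∧ r o = o ∧
      (∀ x, {x, x} ∈ treeSimplices L → {x, r x} ∈ treeSimplices L) ∧
      (∀ x, {x, x} ∈ treeSimplices L → ∃ n, r^[n] x = o) ∧
      ∀ x y, {x, y} ∈ treeSimplices L → x = y ∨ y = r x ∨ x = r y := by
  rcases L.eq_empty_or_nonempty with rfl | hne
  · refine ⟨none, id, ?_⟩
    simp only [pair_mem_treeSimplices_empty]
    refine ⟨⟨trivial, trivial⟩, rfl, fun x h => h, fun x h => ⟨0, h.1⟩, fun x y h => Or.inl ?_⟩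
    rw [h.1, h.2]
  obtain ⟨ℓ₁, hℓ₁, ℓ₂, hℓ₂, hne'⟩ : L.Nontrivial := by
    rw [← Set.not_subsingleton_iff]
    intro hs
    rcases hs.eq_empty_or_singleton with rfl | ⟨a, rfl⟩
    · exact hne.ne_empty rfl
    · exact hL (Set.encard_singleton a)
  have hb : LinearIndependent F ![ℓ₁.rep, ℓ₂.rep] :=
    Projectivization.linearIndependent_pair_iff_ne.mpr hne'
  obtain ⟨π, hπ⟩ := IsDiscreteValuationRing.exists_irreducible 𝒪[F]
  obtain ⟨o, ho⟩ := exists_isClassOf hb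
  set p := parent π (span 𝒪[F] {ℓ₁.rep, ℓ₂.rep}) with hp
  -- Every competing subtree contains `o`, hence also the path from each of its vertices to `o`.
  -- This property passes to the intersection, so neither existence nor connectedness of a smallest
  -- subtree has to be known.
  have hoT : ∀ T : (bruhatTits F).Subgraph, T.Connected ∧ ends T = L → o ∈ T.verts := by
    rintro T ⟨hT, rfl⟩
    exact root_mem_of_ends hπ hb ho hT ℓ₁.submodule_eq ℓ₂.submodule_eq hℓ₁ hℓ₂
  have hoL : o ∈ (hull L).verts := by
    rw [hull, SimpleGraph.Subgraph.verts_sInf]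
    exact Set.mem_iInter₂.mpr hoT
  have hadj : ∀ v ∈ (hull L).verts, v ≠ o → (hull L).Adj v (p v) := by
    intro v hv hvo
    rw [hull, SimpleGraph.Subgraph.verts_sInf] at hv
    rw [hull, SimpleGraph.Subgraph.sInf_adj]
    exact ⟨fun T hT => subgraph_adj_parent_of_ne hπ hb ho hT.1 (hoT T hT)
      (Set.mem_iInter₂.mp hv T hT) hvo, adj_parent hπ hb ho hvo⟩
  have hpo : p o = o := parent_root hπ hb ho
  have hiter : ∀ n v, (Option.map p)^[n] (some v) = some (p^[n] v) := by
    intro n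
    induction n with
    | zero => exact fun _ => rfl
    | succ n ih => exact fun v => by simp [ih]
  refine ⟨some o, Option.map p, ?_⟩
  simp only [pair_mem_treeSimplices hne]
  refine ⟨⟨o, o, rfl, rfl, hoL, Or.inl rfl⟩, by simp [hpo], ?_, ?_, ?_⟩
  · rintro _ ⟨v, w, rfl, h, hv, -⟩
    refine ⟨v, p v, rfl, rfl, hv, ?_⟩
    by_cases hvo : v = o
    · left
      rw [hvo, hpo]
    · exact Or.inr (hadj v hv hvo)
  · rintro _ ⟨v, w, rfl, h, hv, -⟩
    obtain ⟨n, hn⟩ := exists_iterate_parent_eq hπ hb ho v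
    exact ⟨n, by rw [hiter, hn]⟩
  · rintro _ _ ⟨v, w, rfl, rfl, hv, rfl | hvw⟩
    · exact Or.inl rfl
    · rcases parent_of_adj hπ hb ((hull L).adj_sub hvw) with h | h
      · exact Or.inr (Or.inl (congrArg some h))
      · exact Or.inr (Or.inr (congrArg some h))

end Hull

/-! ### The embedding of projective lines induced by a field embedding. -/

section ProjectiveLineMap

variable {F C : Type*} [Field F] [Field C]

theorem gl_smul_mk (g : GL (Fin 2) F) {v : Fin 2 → F} (hv : v ≠ 0) :
    ∃ h, g • Projectivization.mk F v hv =
      Projectivization.mk F ((g : Matrix (Fin 2) (Fin 2) F).mulVec v) h :=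
  ⟨_, rfl⟩

theorem projLineMap_mk (ι : F →+* C) {v : Fin 2 → F} (hv : v ≠ 0) :
    ∃ h, projLineMap ι (Projectivization.mk F v hv) =
      Projectivization.mk C (fun j => ι (v j)) h :=
  ⟨_, rfl⟩

theorem exists_smul_eq_of_map (ι : F →+* C) {v w : Fin 2 → F} (hw : w ≠ 0) {c : C}
    (h : (c • fun j => ι (w j)) = fun j => ι (v j)) : ∃ a : F, ι a = c ∧ a • w = v := by
  obtain ⟨i, hi⟩ := Function.ne_iff.mp hw
  have hi' : ι (w i) ≠ 0 := by simpa using hi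
  have hc : ι (v i / w i) = c := by
    rw [map_div₀, ← congrFun h i]
    exact mul_div_cancel_right₀ c hi'
  refine ⟨v i / w i, hc, funext fun j => ι.injective ?_⟩
  rw [← congrFun h j, ← hc]
  exact map_mul ι _ _

theorem projLineMap_injective (ι : F →+* C) : Function.Injective (projLineMap ι) := by
  intro ℓ ℓ' h
  induction ℓ using Projectivization.ind with
  | h v hv =>
    induction ℓ' using Projectivization.ind with
    | h w hw =>
      obtain ⟨h1, e1⟩ := projLineMap_mk ι hv
      obtain ⟨h2, e2⟩ := projLineMap_mk ι hw
      rw [e1, e2, Projectivization.mk_eq_mk_iff'] at h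
      obtain ⟨c, hc⟩ := h
      obtain ⟨a, -, ha⟩ := exists_smul_eq_of_map ι hw hc
      exact (Projectivization.mk_eq_mk_iff' F v w hv hw).mpr ⟨a, ha⟩

theorem projLineMap_smul (ι : F →+* C) (g : PGL(2, F)) (ℓ : ProjLine F) :
    projLineMap ι (g • ℓ) = (Matrix.ProjGenLinGroup.map ι g : PGL(2, C)) • projLineMap ι ℓ := by
  induction g using Matrix.ProjGenLinGroup.induction_on with
  | mk g =>
    induction ℓ using Projectivization.ind with
    | h v hv =>
      change Projectivization.mk C _ _ = Projectivization.mk C _ _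
      congr 1
      funext j
      exact RingHom.map_mulVec ι (g : Matrix (Fin 2) (Fin 2) F) v j

end ProjectiveLineMap

/-! ### Equivariance of ends, hulls and simplices. -/

section Equivariance

open Submodule

variable {F : Type*} [Field F] [ValuativeRel F]

theorem bruhatTits_adj_smul (g : GL (Fin 2) F) {v w : Vertex F} (h : (bruhatTits F).Adj v w) :
    (bruhatTits F).Adj (g • v) (g • w) := by
  rw [bruhatTits, SimpleGraph.fromRel_adj] at h ⊢
  refine ⟨(MulAction.injective g).ne h.1, ?_⟩
  rcases h.2 with ⟨Λ, Λ', rfl, rfl, h1, h2⟩ | ⟨Λ, Λ', rfl, rfl, h1, h2⟩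
  · exact Or.inl ⟨g • Λ, g • Λ', rfl, rfl, rel_smul g h1 h2⟩
  · exact Or.inr ⟨g • Λ, g • Λ', rfl, rfl, rel_smul g h1 h2⟩

/-- The automorphism of the Bruhat–Tits tree given by `g`. -/
noncomputable def smulHom (g : GL (Fin 2) F) : bruhatTits F →g bruhatTits F where
  toFun v := g • v
  map_rel' := bruhatTits_adj_smul g

theorem restrictScalars_submodule_smul (g : GL (Fin 2) F) (ℓ : ProjLine F) :
    (g • ℓ).submodule.restrictScalars 𝒪[F] =
      (ℓ.submodule.restrictScalars 𝒪[F]).map (intLin g) := by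
  induction ℓ using Projectivization.ind with
  | h v hv =>
    obtain ⟨h, he⟩ := gl_smul_mk g hv
    rw [he, Projectivization.submodule_mk, Projectivization.submodule_mk]
    ext x
    simp only [restrictScalars_mem, mem_span_singleton, Submodule.mem_map]
    constructor
    · rintro ⟨c, rfl⟩
      exact ⟨c • v, ⟨c, rfl⟩, by simp [intLin]⟩
    · rintro ⟨_, ⟨c, rfl⟩, rfl⟩
      exact ⟨c, by simp [intLin]⟩

theorem IsHalfLine.smul (g : GL (Fin 2) F) {r : ℕ → OLattice F} {ℓ : ProjLine F}
    (h : IsHalfLine r ℓ) : IsHalfLine (fun n => g • r n) (g • ℓ) := by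
  intro n
  simp only [smul_val]
  rw [h n, Submodule.map_sup, Submodule.map_inf _ (intLin_injective g), map_smul'',
    restrictScalars_submodule_smul]

theorem smul_mem_ends_map (g : GL (Fin 2) F) {T : (bruhatTits F).Subgraph} {ℓ : ProjLine F}
    (h : ℓ ∈ ends T) : g • ℓ ∈ ends (T.map (smulHom g)) := by
  obtain ⟨r, hr, hT⟩ := h
  exact ⟨_, hr.smul g, fun n => ⟨_, _, hT n, rfl, rfl⟩⟩

theorem map_smulHom_mul (g h : GL (Fin 2) F) (T : (bruhatTits F).Subgraph) :
    (T.map (smulHom g)).map (smulHom h) = T.map (smulHom (h * g)) := by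
  rw [← SimpleGraph.Subgraph.map_comp]
  congr 1
  ext v
  exact (mul_smul h g v).symm

theorem map_smulHom_one (T : (bruhatTits F).Subgraph) : T.map (smulHom 1) = T := by
  have : smulHom (1 : GL (Fin 2) F) = SimpleGraph.Hom.id := by
    ext v
    exact one_smul _ v
  rw [this, SimpleGraph.Subgraph.map_id]

theorem map_connected (g : GL (Fin 2) F) {T : (bruhatTits F).Subgraph} (hT : T.Connected) :
    (T.map (smulHom g)).Connected := by
  refine ⟨SimpleGraph.Connected.map (G := T.coe) ⟨fun v => ⟨g • v.1, v.1, v.2, rfl⟩, ?_⟩ ?_ hT.coe⟩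
  · intro a b hab
    exact ⟨a, b, hab, rfl, rfl⟩
  · rintro ⟨_, v, hv, rfl⟩
    exact ⟨⟨v, hv⟩, rfl⟩

theorem ends_map (g : GL (Fin 2) F) {L : Set (ProjLine F)} (h : ∀ ℓ ∈ L, g • ℓ ∈ L)
    (h' : ∀ ℓ ∈ L, g⁻¹ • ℓ ∈ L) {T : (bruhatTits F).Subgraph} (hT : ends T = L) :
    ends (T.map (smulHom g)) = L := by
  ext ℓ
  constructor
  · intro hℓ
    have h1 := smul_mem_ends_map g⁻¹ hℓ
    rw [map_smulHom_mul, inv_mul_cancel, map_smulHom_one, hT] at h1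
    simpa using h _ h1
  · intro hℓ
    have h1 := smul_mem_ends_map (T := T) g (hT ▸ h' ℓ hℓ)
    simpa using h1

/-- Translation by `g⁻¹` sends the family of subtrees defining the hull into itself, so its
intersection is carried into itself by `g`. -/
theorem hull_smul (g : GL (Fin 2) F) {L : Set (ProjLine F)} (h : ∀ ℓ ∈ L, g • ℓ ∈ L)
    (h' : ∀ ℓ ∈ L, g⁻¹ • ℓ ∈ L) :
    (∀ v ∈ (hull L).verts, g • v ∈ (hull L).verts) ∧
      ∀ v w, (hull L).Adj v w → (hull L).Adj (g • v) (g • w) := by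
  have key : ∀ T : (bruhatTits F).Subgraph, T.Connected ∧ ends T = L →
      (T.map (smulHom g⁻¹)).Connected ∧ ends (T.map (smulHom g⁻¹)) = L := fun T hT =>
    ⟨map_connected _ hT.1, ends_map g⁻¹ h' (by simpa using h) hT.2⟩
  constructor
  · intro v hv
    rw [hull, SimpleGraph.Subgraph.verts_sInf] at hv ⊢
    refine Set.mem_iInter₂.mpr fun T hT => ?_
    obtain ⟨w, hw, hwv⟩ := Set.mem_iInter₂.mp hv _ (key T hT)
    have : g • v = w := by
      rw [← hwv]
      exact smul_inv_smul g w
    rwa [this]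
  · intro v w hvw
    rw [hull, SimpleGraph.Subgraph.sInf_adj] at hvw ⊢
    refine ⟨fun T hT => ?_, bruhatTits_adj_smul g hvw.2⟩
    obtain ⟨a, b, hab, rfl, rfl⟩ := hvw.1 _ (key T hT)
    change T.Adj (g • g⁻¹ • a) (g • g⁻¹ • b)
    rwa [smul_inv_smul, smul_inv_smul]

theorem smul_pair_mem_treeSimplices (g : PGL(2, F)) {L : Set (ProjLine F)}
    (h : ∀ ℓ ∈ L, g • ℓ ∈ L) (h' : ∀ ℓ ∈ L, g⁻¹ • ℓ ∈ L) {x y : Option (Vertex F)}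
    (hxy : {x, y} ∈ treeSimplices L) : {g • x, g • y} ∈ treeSimplices L := by
  rcases L.eq_empty_or_nonempty with rfl | hne
  · rw [pair_mem_treeSimplices_empty] at hxy ⊢
    rw [hxy.1, hxy.2]
    exact ⟨rfl, rfl⟩
  · rw [pair_mem_treeSimplices hne] at hxy ⊢
    obtain ⟨v, w, rfl, rfl, hv, hvw⟩ := hxy
    induction g using Matrix.ProjGenLinGroup.induction_on with
    | mk g =>
      obtain ⟨h1, h2⟩ := hull_smul g h h'
      refine ⟨g • v, g • w, rfl, rfl, h1 v hv, ?_⟩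
      rcases hvw with rfl | hvw
      · exact Or.inl rfl
      · exact Or.inr (h2 _ _ hvw)

end Equivariance

/-! ### Points of the projective line over `C` that are not rational over `F`. -/

section Irrational

variable {F : Type*} [Field F] [ValuativeRel F]

/-- If `b⁻¹` had valuation `n > 0`, an `(n + 1)`-th root of it would have positive valuation,
forcing `n + 1 ≤ n`. -/
theorem mem_integer_of_forall_exists_pow_eq [IsDiscreteValuationRing 𝒪[F]] {b : F}
    (h : ∀ n : ℕ, 0 < n → ∃ b' : F, b' ^ n = b) : b ∈ 𝒪[F] := by
  by_contra hb
  obtain ⟨π, hπ⟩ := IsDiscreteValuationRing.exists_irreducible 𝒪[F]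
  have hb0 : b ≠ 0 := fun h => hb (h ▸ zero_mem _)
  have hinv : ∀ {c : F}, c ∉ 𝒪[F] → ∃ t : 𝒪[F], (t : F) = c⁻¹ ∧ π ∣ t := by
    intro c hc
    rcases exists_integer_or_inv c with ⟨t, rfl⟩ | ⟨t, ht⟩
    · exact absurd t.2 hc
    · refine ⟨t, ht, ?_⟩
      have : t ∈ IsLocalRing.maximalIdeal 𝒪[F] := by
        intro hu
        obtain ⟨s, hs⟩ := hu.exists_left_inv
        have hs' := congrArg Subtype.val hs
        push_cast at hs'
        rw [ht] at hs'
        have hc0 : c ≠ 0 := fun h => hc (h ▸ zero_mem _)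
        have : (s : F) = c := by
          field_simp at hs'
          exact hs'
        exact hc (this ▸ s.2)
      rwa [hπ.maximalIdeal_eq, Ideal.mem_span_singleton] at this
  obtain ⟨t, ht, -⟩ := hinv hb
  have ht0 : t ≠ 0 := by
    rintro rfl
    exact inv_ne_zero hb0 (by simpa using ht.symm)
  obtain ⟨n, u, hu⟩ := IsDiscreteValuationRing.associated_pow_irreducible ht0 hπ
  obtain ⟨b', hb'⟩ := h (n + 1) n.succ_pos
  have hb'O : b' ∉ 𝒪[F] := fun h' => hb (hb' ▸ pow_mem h' _)
  obtain ⟨t', ht', hdvd⟩ := hinv hb'O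
  have htt : t = t' ^ (n + 1) := by
    apply Subtype.ext
    push_cast
    rw [ht, ht', ← hb', inv_pow]
  have h1 : π ^ (n + 1) ∣ π ^ n := by
    rw [← hu, htt]
    exact (pow_dvd_pow_of_dvd hdvd _).mul_right _
  exact absurd ((pow_dvd_pow_iff hπ.ne_zero hπ.not_isUnit).mp h1) (by simp)

/-- If `ι` were onto, elements of the algebraic closure, having all roots, would come from `𝒪[F]` by
the preceding lemma. Its image is compact, hence bounded, whereas the norm on `k` is not. -/
theorem exists_notMem_range (k : Type*) [NontriviallyNormedField k] [IsUltrametricDist k]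
    [ProperSpace k] [TopologicalSpace F] [IsNonarchimedeanLocalField F]
    (ι : F →+* CompletedAlgClosure k) (hι : Continuous ι) : ∃ η, η ∉ Set.range ι := by
  by_contra! hsurj
  have hmem : ∀ z : AlgebraicClosure k, (z : CompletedAlgClosure k) ∈ ι '' (𝒪[F] : Set F) := by
    intro z
    obtain ⟨b, hb⟩ := hsurj z
    refine ⟨b, mem_integer_of_forall_exists_pow_eq fun n hn => ?_, hb⟩
    obtain ⟨z', rfl⟩ := IsAlgClosed.exists_pow_nat_eq z hn
    obtain ⟨b', hb'⟩ := hsurj z'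
    refine ⟨b', ι.injective ?_⟩
    rw [map_pow, hb', hb]
    exact (map_pow UniformSpace.Completion.coeRingHom z' n).symm
  have hcomp : IsCompact (ι '' (𝒪[F] : Set F)) :=
    (isCompact_iff_compactSpace.mpr (inferInstanceAs (CompactSpace 𝒪[F]))).image hι
  obtain ⟨R, hR⟩ := hcomp.isBounded.exists_norm_le
  obtain ⟨a, ha⟩ := NormedField.exists_one_lt_norm k
  obtain ⟨n, hn⟩ := pow_unbounded_of_one_lt R ha
  have h1 := hR _ (hmem (algebraMap k (AlgebraicClosure k) a ^ n))
  rw [UniformSpace.Completion.norm_coe, norm_pow] at h1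
  have h2 : ‖algebraMap k (AlgebraicClosure k) a‖ = ‖a‖ := spectralNorm_extends a
  rw [h2] at h1
  exact absurd hn h1.not_gt

end Irrational

section IrrationalPoints

variable {F C : Type*} [Field F] [Field C]

theorem map_smul_notMem_range (ι : F →+* C) (g : PGL(2, F)) {x : ProjLine C}
    (hx : x ∉ Set.range (projLineMap ι)) :
    (Matrix.ProjGenLinGroup.map ι g : PGL(2, C)) • x ∉ Set.range (projLineMap ι) := by
  rintro ⟨ℓ, hℓ⟩
  refine hx ⟨g⁻¹ • ℓ, ?_⟩
  rw [projLineMap_smul, hℓ, map_inv, inv_smul_smul]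

theorem mk_one_notMem_range (ι : F →+* C) {η : C} (hη : η ∉ Set.range ι)
    (h : (![1, η] : Fin 2 → C) ≠ 0) :
    Projectivization.mk C ![1, η] h ∉ Set.range (projLineMap ι) := by
  rintro ⟨ℓ, hℓ⟩
  induction ℓ using Projectivization.ind with
  | h v hv =>
    obtain ⟨h1, e1⟩ := projLineMap_mk ι hv
    rw [e1, Projectivization.mk_eq_mk_iff'] at hℓ
    obtain ⟨c, hc⟩ := hℓ
    have h0 : c * 1 = ι (v 0) := congrFun hc 0
    have h2 : c * η = ι (v 1) := congrFun hc 1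
    have hc0 : c ≠ 0 := by
      rintro rfl
      exact h1 (by rw [← hc, zero_smul])
    refine hη ⟨v 1 / v 0, ?_⟩
    rw [map_div₀, ← h0, ← h2]
    field_simp

end IrrationalPoints

/-! ### Compactness of orbits under vertex stabilizers. -/

section IntegralMatrices

open Submodule

variable {F : Type*} [Field F] [ValuativeRel F]

theorem conj_entry_mem {x y : Fin 2 → F} {B h : GL (Fin 2) F}
    (hB : (B : Matrix (Fin 2) (Fin 2) F) = Matrix.of fun i j => ![x, y] j i)
    (hh : ∀ z ∈ span 𝒪[F] {x, y}, (h : Matrix (Fin 2) (Fin 2) F).mulVec z ∈ span 𝒪[F] {x, y})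
    (i j : Fin 2) : ((B⁻¹ * h * B : GL (Fin 2) F) : Matrix (Fin 2) (Fin 2) F) i j ∈ 𝒪[F] := by
  have hcol : ∀ j, (B : Matrix (Fin 2) (Fin 2) F).mulVec (Pi.single j 1) = ![x, y] j := by
    intro j
    rw [Matrix.mulVec_single_one, hB]
    rfl
  have hcomb : ∀ s t : 𝒪[F], (B : Matrix (Fin 2) (Fin 2) F).mulVec ![(s : F), t] =
      s • x + t • y := by
    intro s t
    have : (![(s : F), t] : Fin 2 → F) = (s : F) • Pi.single 0 1 + (t : F) • Pi.single 1 1 := by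
      ext j; fin_cases j <;> simp
    rw [this, Matrix.mulVec_add, Matrix.mulVec_smul, Matrix.mulVec_smul, hcol, hcol]
    rfl
  have hz : ![x, y] j ∈ span 𝒪[F] {x, y} := by
    fin_cases j <;> exact subset_span (by simp)
  obtain ⟨s, t, hst⟩ := mem_span_pair.mp (hh _ hz)
  have hcalc : ((B⁻¹ * h * B : GL (Fin 2) F) : Matrix (Fin 2) (Fin 2) F).mulVec (Pi.single j 1) =
      ![(s : F), t] := by
    rw [Units.val_mul, Units.val_mul, ← Matrix.mulVec_mulVec, ← Matrix.mulVec_mulVec, hcol, ← hst,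
      ← hcomb, Matrix.mulVec_mulVec, ← Units.val_mul, inv_mul_cancel, Units.val_one,
      Matrix.one_mulVec]
  rw [Matrix.mulVec_single_one] at hcalc
  have := congrFun hcalc i
  rw [Matrix.col_apply] at this
  rw [this]
  fin_cases i
  · exact s.2
  · exact t.2

end IntegralMatrices

section ProjectiveLineTopology

variable {C : Type*} [Field C] [TopologicalSpace C]

theorem tendsto_projLine_mk {α : Type*} {l : Filter α} {w : α → Fin 2 → C} {w₀ : Fin 2 → C}
    (h : Filter.Tendsto w l (𝓝 w₀)) (hw : ∀ a, w a ≠ 0) (hw₀ : w₀ ≠ 0) :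
    Filter.Tendsto (fun a => Projectivization.mk C (w a) (hw a)) l
      (𝓝 (Projectivization.mk C w₀ hw₀)) := by
  have hc : Continuous (Projectivization.mk' C : {v : Fin 2 → C // v ≠ 0} → ProjLine C) :=
    continuous_coinduced_rng
  have h1 : Filter.Tendsto (fun a => (⟨w a, hw a⟩ : {v : Fin 2 → C // v ≠ 0})) l
      (𝓝 ⟨w₀, hw₀⟩) := tendsto_subtype_rng.mpr h
  exact (hc.tendsto _).comp h1

theorem continuous_pgl_smul [IsTopologicalRing C] (g : PGL(2, C)) :
    Continuous fun x : ProjLine C => g • x := by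
  induction g using Matrix.ProjGenLinGroup.induction_on with
  | mk g =>
    have hc : Continuous (Projectivization.mk' C : {v : Fin 2 → C // v ≠ 0} → ProjLine C) :=
      continuous_coinduced_rng
    refine continuous_coinduced_dom.mpr ?_
    have h1 : Continuous fun v : {v : Fin 2 → C // v ≠ 0} =>
        (⟨(g : Matrix (Fin 2) (Fin 2) C).mulVec v.1, (gl_smul_mk g v.2).choose⟩ :
          {v : Fin 2 → C // v ≠ 0}) :=
      Continuous.subtype_mk (continuous_const.matrix_mulVec continuous_subtype_val) _
    exact hc.comp h1

end ProjectiveLineTopology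

section Compactness

open Submodule

variable {F : Type*} [Field F] [ValuativeRel F] [TopologicalSpace F] [IsNonarchimedeanLocalField F]
  {C : Type*} [Field C] [TopologicalSpace C]

theorem isCompact_integer : IsCompact (𝒪[F] : Set F) :=
  isCompact_iff_compactSpace.mpr (inferInstanceAs (CompactSpace 𝒪[F]))

/-- The projective line over `F` is contained in the image of a compact set. -/
theorem exists_isCompact_projLine (ι : F →+* C) (hι : Continuous ι) :
    ∃ (y : ProjLine C) (K : Set (Fin 2 → C)), IsCompact K ∧ (∀ w ∈ K, w ≠ 0) ∧
      ∀ g : PGL(2, F), ∃ w ∈ K, ∃ hw : w ≠ 0,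
        (Matrix.ProjGenLinGroup.map ι g : PGL(2, C)) • y = Projectivization.mk C w hw := by
  have h1 : (![1, 0] : Fin 2 → F) ≠ 0 := fun h => one_ne_zero (congrFun h 0)
  refine ⟨projLineMap ι (Projectivization.mk F _ h1),
    (fun t => ![ι t, 1]) '' (𝒪[F] : Set F) ∪ (fun t => ![1, ι t]) '' (𝒪[F] : Set F),
    (isCompact_integer.image ?_).union (isCompact_integer.image ?_), ?_, fun g => ?_⟩
  · exact continuous_pi fun j => by fin_cases j <;> simp <;> fun_prop
  · exact continuous_pi fun j => by fin_cases j <;> simp <;> fun_prop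
  · rintro _ (⟨t, -, rfl⟩ | ⟨t, -, rfl⟩) h
    · exact one_ne_zero (congrFun h 1)
    · exact one_ne_zero (congrFun h 0)
  · rw [← projLineMap_smul]
    generalize g • Projectivization.mk F _ h1 = ℓ
    induction ℓ using Projectivization.ind with
    | h v hv =>
      obtain ⟨h2, e2⟩ := projLineMap_mk ι hv
      rw [e2]
      rcases exists_integer_mul (v 0) (v 1) with ⟨t, ht⟩ | ⟨t, ht⟩
      · refine ⟨_, Or.inl ⟨t, t.2, rfl⟩, fun h => one_ne_zero (congrFun h 1), ?_⟩
        rw [Projectivization.mk_eq_mk_iff']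
        refine ⟨ι (v 1), ?_⟩
        ext j
        fin_cases j
        · simp [ht, mul_comm]
        · simp
      · refine ⟨_, Or.inr ⟨t, t.2, rfl⟩, fun h => one_ne_zero (congrFun h 0), ?_⟩
        rw [Projectivization.mk_eq_mk_iff']
        refine ⟨ι (v 0), ?_⟩
        ext j
        fin_cases j
        · simp
        · simp [ht, mul_comm]

variable [IsTopologicalRing C] [T2Space C]

/-- The matrices of `GL₂(𝒪)`, together with their inverses. -/
def integralPairs (F : Type*) [Field F] [ValuativeRel F] :
    Set (Matrix (Fin 2) (Fin 2) F × Matrix (Fin 2) (Fin 2) F) :=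
  {p | (∀ i j, p.1 i j ∈ 𝒪[F]) ∧ (∀ i j, p.2 i j ∈ 𝒪[F]) ∧ p.1 * p.2 = 1}

/-- Recording the inverse turns invertibility over `𝒪[F]` into a closed condition on a product of
compact sets. -/
theorem isCompact_integralPairs [T2Space F] : IsCompact (integralPairs F) := by
  have h1 : IsCompact {m : Matrix (Fin 2) (Fin 2) F | ∀ i, m i ∈ {v : Fin 2 → F | ∀ j, v j ∈ 𝒪[F]}} :=
    isCompact_pi_infinite fun _ => isCompact_pi_infinite fun _ => isCompact_integer
  have h2 : IsClosed {p : Matrix (Fin 2) (Fin 2) F × Matrix (Fin 2) (Fin 2) F | p.1 * p.2 = 1} :=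
    isClosed_eq (continuous_fst.matrix_mul continuous_snd) continuous_const
  convert (h1.prod h1).inter_right h2 using 1
  ext p
  simp only [integralPairs, Set.mem_ofPred_eq, Set.mem_inter_iff, Set.mem_prod, and_assoc]

/-- The orbit of a point outside `ℙ¹(F)` under a vertex stabilizer is contained in the image of a
compact set. -/
theorem exists_isCompact_of_stabilizer (ι : F →+* C) (hι : Continuous ι) {η : C}
    (hη : η ∉ Set.range ι) (v : Vertex F) :
    ∃ (y : ProjLine C) (K : Set (Fin 2 → C)), IsCompact K ∧
      (∀ w ∈ K, ∃ hw : w ≠ 0, Projectivization.mk C w hw ∉ Set.range (projLineMap ι)) ∧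
      ∀ g : PGL(2, F), g • v = v → ∃ w ∈ K, ∃ hw : w ≠ 0,
        (Matrix.ProjGenLinGroup.map ι g : PGL(2, C)) • y = Projectivization.mk C w hw := by
  have : T2Space F := T2Space.of_injective_continuous ι.injective hι
  obtain ⟨Λ, rfl⟩ : ∃ Λ : OLattice F, Λ.cls = v := Quotient.exists_rep v
  obtain ⟨x, y, hΛ⟩ := exists_span_pair Λ.2
  have hli := linearIndependent_of_isLattice (hΛ ▸ Λ.2)
  obtain ⟨B, hB⟩ : ∃ B : GL (Fin 2) F,
      (B : Matrix (Fin 2) (Fin 2) F) = Matrix.of fun i j => ![x, y] j i :=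
    (Matrix.linearIndependent_cols_iff_isUnit (A := Matrix.of fun i j => ![x, y] j i)).mp hli
  have h1η : (![1, η] : Fin 2 → C) ≠ 0 := fun h => one_ne_zero (congrFun h 0)
  -- In the basis `B` of the lattice, its stabilizer is `B GL₂(𝒪) B⁻¹`. With `y = B • [1 : η]`, the
  -- orbit of `y` is represented by the vectors `B m (1, η)` with `m` in the compact group `GL₂(𝒪)`.
  set φ : Matrix (Fin 2) (Fin 2) F → Fin 2 → C := fun m =>
    (((B : Matrix (Fin 2) (Fin 2) F) * m).map ι).mulVec ![1, η] with hφ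
  have hφc : Continuous φ :=
    Continuous.matrix_mulVec ((continuous_const.matrix_mul continuous_id).matrix_map hι)
      continuous_const
  have key : ∀ m : GL (Fin 2) F, ∃ hw : φ m ≠ 0, Projectivization.mk C (φ m) hw =
      (Matrix.ProjGenLinGroup.map ι (Matrix.ProjGenLinGroup.mk (B * m)) : PGL(2, C)) •
        Projectivization.mk C ![1, η] h1η := by
    intro m
    have hcoe : ((Matrix.GeneralLinearGroup.map ι (B * m) : GL (Fin 2) C) :
        Matrix (Fin 2) (Fin 2) C).mulVec ![1, η] = φ m := rfl
    obtain ⟨hw, he⟩ := gl_smul_mk (Matrix.GeneralLinearGroup.map ι (B * m)) h1η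
    simp only [hcoe] at hw he
    exact ⟨hw, he.symm⟩
  clear_value φ
  refine ⟨(Matrix.ProjGenLinGroup.map ι (Matrix.ProjGenLinGroup.mk B) : PGL(2, C)) •
    Projectivization.mk C ![1, η] h1η, (fun p => φ p.1) '' integralPairs F,
    isCompact_integralPairs.image (show Continuous fun p : Matrix (Fin 2) (Fin 2) F ×
      Matrix (Fin 2) (Fin 2) F => φ p.1 from hφc.comp continuous_fst), ?_, ?_⟩
  · rintro _ ⟨⟨m, m'⟩, hm, rfl⟩
    obtain ⟨hw, he⟩ := key ⟨m, m', hm.2.2, mul_eq_one_comm.mp hm.2.2⟩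
    exact ⟨hw, he ▸ map_smul_notMem_range ι _ (mk_one_notMem_range ι hη h1η)⟩
  · intro g hg
    -- Fixing the homothety class means fixing `Λ` up to a scalar, which the choice of lift to `GL₂`
    -- absorbs.
    obtain ⟨h, rfl, hh⟩ : ∃ h : GL (Fin 2) F, Matrix.ProjGenLinGroup.mk h = g ∧ h • Λ = Λ := by
      induction g using Matrix.ProjGenLinGroup.induction_on with
      | mk h =>
        obtain ⟨c, hc⟩ := Quotient.exact (show (h • Λ).cls = Λ.cls from hg)
        refine ⟨Matrix.GeneralLinearGroup.scalar (Fin 2) c * h, ?_, by rw [mul_smul, hc]⟩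
        rw [map_mul, Matrix.ProjGenLinGroup.mk_scalar, one_mul]
    have hpres : ∀ {h : GL (Fin 2) F}, h • Λ = Λ → ∀ z ∈ span 𝒪[F] {x, y},
        (h : Matrix (Fin 2) (Fin 2) F).mulVec z ∈ span 𝒪[F] {x, y} := by
      intro h hh z hz
      rw [← hΛ] at hz ⊢
      have : intLin h z ∈ (h • Λ).1 := Submodule.mem_map_of_mem hz
      rwa [hh] at this
    obtain ⟨hw, he⟩ := key (B⁻¹ * h * B)
    refine ⟨_, ⟨(((B⁻¹ * h * B : GL (Fin 2) F) : Matrix (Fin 2) (Fin 2) F),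
      ((B⁻¹ * h⁻¹ * B : GL (Fin 2) F) : Matrix (Fin 2) (Fin 2) F)), ⟨?_, ?_, ?_⟩, rfl⟩, hw, ?_⟩
    · exact conj_entry_mem hB (hpres hh)
    · exact conj_entry_mem hB (hpres (inv_smul_eq_iff.mpr hh.symm))
    · rw [← Units.val_mul]
      simp [mul_assoc]
    · rw [he, smul_smul, ← map_mul, ← map_mul, mul_assoc, mul_inv_cancel_left]

end Compactness

/-! ### Invariance of the local limit sets. -/

section LimitSets

variable {S : Type*} {F : S → Type*} [∀ i, Field (F i)] {C : Type*} [NormedField C]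
  {ι : ∀ i, F i →+* C} {Γ : Subgroup (∀ i, PGL(2, F i))} {L : ∀ i, Set (ProjLine (F i))}

theorem act_mul (g h : ∀ i, PGL(2, F i)) (x : S → ProjLine C) :
    act ι (g * h) x = act ι g (act ι h x) := by
  funext i
  simp only [act, Pi.mul_apply, map_mul, mul_smul]

theorem act_mem_limitPoints {γ : ∀ i, PGL(2, F i)} (hγ : γ ∈ Γ) {x : S → ProjLine C}
    (hx : x ∈ limitPoints ι Γ) : act ι γ x ∈ limitPoints ι Γ := by
  obtain ⟨y, g, hinj, hg, hlim⟩ := hx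
  refine ⟨y, fun j => γ * g j, fun a b hab => hinj (mul_left_cancel hab),
    fun j => mul_mem hγ (hg j), ?_⟩
  simp only [act_mul]
  rw [tendsto_pi_nhds] at hlim ⊢
  exact fun i => ((continuous_pgl_smul _).tendsto _).comp (hlim i)

/-- The limit set is invariant. The test point is `ℓ` at `i` and irrational elsewhere, so after
translation only the coordinate `i` can witness membership in the limit set. -/
theorem HasLocalLimitSets.smul_mem (hL : HasLocalLimitSets ι Γ L)
    (hirr : ∀ i, ∃ z, z ∉ Set.range (projLineMap (ι i))) {γ : ∀ i, PGL(2, F i)} (hγ : γ ∈ Γ)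
    {i : S} {ℓ : ProjLine (F i)} (hℓ : ℓ ∈ L i) : γ i • ℓ ∈ L i := by
  classical
  choose z hz using hirr
  have h1 : Function.update z i (projLineMap (ι i) ℓ) ∈ limitPoints ι Γ := by
    rw [hL]
    exact ⟨i, by simpa using Set.mem_image_of_mem _ hℓ⟩
  have h2 := act_mem_limitPoints hγ h1
  rw [hL] at h2
  obtain ⟨j, hj⟩ := h2
  by_cases hji : j = i
  · subst hji
    simp only [act, Function.update_self] at hj
    rw [← projLineMap_smul] at hj
    obtain ⟨ℓ', hℓ', he⟩ := hj
    rwa [← projLineMap_injective _ he]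
  · simp only [act, Function.update_of_ne hji] at hj
    exact absurd (Set.image_subset_range _ _ hj) (map_smul_notMem_range _ _ (hz j))

end LimitSets

/-! ### The product of trees, finite stabilizers, and the conclusion. -/

section Main

variable {S : Type*} {F : S → Type*} [∀ i, Field (F i)] [∀ i, ValuativeRel (F i)]
  {L : ∀ i, Set (ProjLine (F i))}

variable (L) in
/-- The vertices of the product of the trees attached to `L i`. -/
def TreeProduct : Type _ :=
  {x : ∀ i, Option (Vertex (F i)) // ∀ i, {x i, x i} ∈ treeSimplices (L i)}

/-- Two vertices of the product of trees are adjacent if they lie in a common polysimplex. -/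
def TreeProduct.Adj (x y : TreeProduct L) : Prop :=
  ∀ i, {x.1 i, y.1 i} ∈ treeSimplices (L i)

theorem TreeProduct.exists_graphContraction [Finite S] [∀ i, IsDiscreteValuationRing 𝒪[F i]]
    (hL : ∀ i, (L i).encard ≠ 1) :
    ∃ (r : TreeProduct L → TreeProduct L) (o : TreeProduct L),
      GraphContraction (TreeProduct.Adj (L := L)) r o := by
  choose o r ho hro hr hiter hedge using fun i => exists_treeContraction (L i) (hL i)
  have hsymm : ∀ i x y, {x, y} ∈ treeSimplices (L i) → {y, x} ∈ treeSimplices (L i) :=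
    fun i x y h => by rwa [Set.pair_comm]
  have hright : ∀ i x y, {x, y} ∈ treeSimplices (L i) → {y, y} ∈ treeSimplices (L i) := by
    intro i x y h
    rcases (L i).eq_empty_or_nonempty with he | hne
    · rw [he, pair_mem_treeSimplices_empty] at h ⊢
      exact ⟨h.2, h.2⟩
    · rw [pair_mem_treeSimplices hne] at h ⊢
      obtain ⟨v, w, rfl, rfl, hv, rfl | hvw⟩ := h
      · exact ⟨v, v, rfl, rfl, hv, Or.inl rfl⟩
      · exact ⟨w, w, rfl, rfl, (hull (L i)).edge_vert hvw.symm, Or.inl rfl⟩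
  let R : TreeProduct L → TreeProduct L := fun x =>
    ⟨fun i => r i (x.1 i), fun i => hright i _ _ (hr i _ (x.2 i))⟩
  have hR : ∀ n x i, (R^[n] x).1 i = (r i)^[n] (x.1 i) := by
    intro n
    induction n with
    | zero => exact fun _ _ => rfl
    | succ n ih => exact fun x i => ih (R x) i
  refine ⟨R, ⟨o, ho⟩, fun v => v.2, fun v w h i => hsymm i _ _ (h i), fun v i => hr i _ (v.2 i),
    Subtype.ext (funext hro), fun v => ?_, fun v w hvw => ?_⟩
  · choose n hn using fun i => hiter i (v.1 i) (v.2 i)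
    obtain ⟨N, hN⟩ := Finite.exists_le n
    refine ⟨N, Subtype.ext (funext fun i => ?_)⟩
    rw [hR]
    obtain ⟨m, rfl⟩ := Nat.exists_eq_add_of_le' (hN i)
    rw [Function.iterate_add_apply, hn, Function.iterate_fixed (hro i)]
  · have key : ∀ i, {r i (v.1 i), r i (w.1 i)} ∈ treeSimplices (L i) ∧
        ∃ u, {v.1 i, u} ∈ treeSimplices (L i) ∧ {w.1 i, u} ∈ treeSimplices (L i) ∧
          {r i (v.1 i), u} ∈ treeSimplices (L i) ∧ {r i (w.1 i), u} ∈ treeSimplices (L i) := by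
      intro i
      have hv := hr i _ (v.2 i)
      have hw := hr i _ (w.2 i)
      rcases hedge i _ _ (hvw i) with h | h | h
      · rw [← h]
        exact ⟨hright i _ _ hv, v.1 i, v.2 i, v.2 i, hsymm i _ _ hv, hsymm i _ _ hv⟩
      · refine ⟨by rw [← h]; exact hw, w.1 i, hvw i, w.2 i, by rw [← h]; exact w.2 i,
          hsymm i _ _ hw⟩
      · refine ⟨by rw [← h]; exact hsymm i _ _ hv, v.1 i, v.2 i, hsymm i _ _ (hvw i),
          hsymm i _ _ hv, by rw [← h]; exact v.2 i⟩
    choose h1 u h2 h3 h4 h5 using key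
    exact ⟨h1, ⟨u, fun i => hright i _ _ (h2 i)⟩, h2, h3, h4, h5⟩

variable {Γ : Subgroup (∀ i, PGL(2, F i))}

/-- The action of a group which preserves the sets of ends on the product of trees. -/
@[reducible]
noncomputable def TreeProduct.mulAction
    (hΓ : ∀ γ ∈ Γ, ∀ i, ∀ ℓ ∈ L i, γ i • ℓ ∈ L i) : MulAction Γ (TreeProduct L) where
  smul γ x := ⟨fun i => γ.1 i • x.1 i, fun i =>
    smul_pair_mem_treeSimplices (γ.1 i) (hΓ γ.1 γ.2 i) (hΓ γ.1⁻¹ (inv_mem γ.2) i) (x.2 i)⟩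
  one_smul x := Subtype.ext (funext fun i => one_smul _ (x.1 i))
  mul_smul γ δ x := Subtype.ext (funext fun i => mul_smul (γ.1 i) (δ.1 i) (x.1 i))

theorem isFinitelyPresented_of_finite_stabilizer [Finite S]
    [∀ i, IsDiscreteValuationRing 𝒪[F i]] (hL : ∀ i, (L i).encard ≠ 1)
    (hΓ : ∀ γ ∈ Γ, ∀ i, ∀ ℓ ∈ L i, γ i • ℓ ∈ L i) (hfin : FiniteQuotient Γ L)
    (hstab : ∀ x : TreeProduct L, {γ : Γ | ∀ i, γ.1 i • x.1 i = x.1 i}.Finite) :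
    Group.IsFinitelyPresented Γ := by
  let := TreeProduct.mulAction hΓ
  have hsmul : ∀ (γ : Γ) (x : TreeProduct L) i, (γ • x).1 i = γ.1 i • x.1 i := fun _ _ _ => rfl
  have hmove : ∀ x y : TreeProduct L, {γ : Γ | γ • x = y}.Finite := by
    intro x y
    rcases Set.eq_empty_or_nonempty {γ : Γ | γ • x = y} with h | ⟨δ, hδ⟩
    · rw [h]
      exact Set.finite_empty
    · refine ((hstab x).image fun γ => δ * γ).subset fun γ hγ => ⟨δ⁻¹ * γ, fun i => ?_, by simp⟩
      have h1 : (δ⁻¹ * γ) • x = x := by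
        rw [mul_smul, show γ • x = y from hγ, inv_smul_eq_iff]
        exact (show δ • x = y from hδ).symm
      exact congrFun (congrArg Subtype.val h1) i
  obtain ⟨r, o, hro⟩ := TreeProduct.exists_graphContraction hL
  let q : TreeProduct L → Quotient (MulAction.orbitRel Γ (∀ i, Set (Option (Vertex (F i))))) :=
    fun x => Quotient.mk _ fun i => {x.1 i}
  have hq : (Set.range q).Finite := by
    refine hfin.subset ?_
    rintro _ ⟨x, rfl⟩
    exact ⟨_, fun i => by simpa using x.2 i, rfl⟩
  have : Finite (Set.range q) := hq
  have hadj : ∀ (γ : Γ) (v w : TreeProduct L), v.Adj w → (γ • v).Adj (γ • w) :=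
    fun γ v w h i =>
      smul_pair_mem_treeSimplices (γ.1 i) (hΓ γ.1 γ.2 i) (hΓ γ.1⁻¹ (inv_mem γ.2) i) (h i)
  refine Group.IsFinitelyPresented.of_graphContraction hro hadj
    (D₀ := Set.range fun c : Set.range q => c.2.choose) (Set.finite_range _) ?_ ?_
  · intro v
    have h1 := (⟨v, rfl⟩ : q v ∈ Set.range q).choose_spec
    obtain ⟨γ, hγ⟩ := MulAction.orbitRel_apply.mp (Quotient.exact h1.symm)
    refine ⟨γ, _, ⟨⟨q v, v, rfl⟩, rfl⟩, Subtype.ext (funext fun i => ?_)⟩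
    have h2 : γ.1 i • ({(_ : TreeProduct L).1 i} : Set (Option (Vertex (F i)))) = {v.1 i} :=
      congrFun hγ i
    rw [Set.smul_set_singleton] at h2
    exact Set.singleton_injective h2
  · intro d d'
    -- Local finiteness is not assumed. The elements `γ` are sorted by the orbit of the polysimplex
    -- on `γ • d` and `d'`, and there are finitely many orbits.
    refine Set.Finite.of_finite_fibers (fun γ : Γ => (Quotient.mk _ fun i =>
      {(γ • d).1 i, d'.1 i} : Quotient (MulAction.orbitRel Γ
        (∀ i, Set (Option (Vertex (F i))))))) (hfin.subset ?_) ?_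
    · rintro _ ⟨γ, hγ, rfl⟩
      exact ⟨_, hγ, rfl⟩
    · rintro _ ⟨γ₀, hγ₀, rfl⟩
      set W : Set (TreeProduct L) := {u | ∀ i, u.1 i ∈ ({(γ₀ • d).1 i, d'.1 i} : Set _)} with hW
      have hWfin : W.Finite := by
        have h1 : {f : ∀ i, Option (Vertex (F i)) |
            ∀ i, f i ∈ ({(γ₀ • d).1 i, d'.1 i} : Set _)}.Finite :=
          Set.Finite.pi' fun i => Set.toFinite _
        exact h1.preimage Subtype.val_injective.injOn
      -- If `δ` carries the reference polysimplex to that of `γ`, then `d' = δ • v` and `γ • d = δ •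
      -- u` with `u`, `v` in the finite set `W`. Finite stabilizers leave finitely many `δ`, and
      -- then finitely many `γ`.
      have hbig : (⋃ v ∈ W, ⋃ δ ∈ {δ : Γ | δ • v = d'}, ⋃ u ∈ W,
          {γ : Γ | γ • d = δ • u}).Finite :=
        hWfin.biUnion fun v _ => (hmove v d').biUnion fun δ _ => hWfin.biUnion fun u _ => hmove _ _
      refine hbig.subset ?_
      rintro γ ⟨-, hγ⟩
      obtain ⟨δ, hδ⟩ := MulAction.orbitRel_apply.mp (Quotient.exact hγ)
      have hmem : ∀ x : TreeProduct L, (∀ i, x.1 i ∈ ({(γ • d).1 i, d'.1 i} : Set _)) →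
          δ⁻¹ • x ∈ W := by
        intro x hx i
        have h1 : δ.1 i • ({(γ₀ • d).1 i, d'.1 i} : Set (Option (Vertex (F i)))) =
          {(γ • d).1 i, d'.1 i} := congrFun hδ i
        have h2 := hx i
        rw [← h1, Set.mem_smul_set_iff_inv_smul_mem] at h2
        exact h2
      simp only [Set.mem_iUnion]
      exact ⟨δ⁻¹ • d', hmem d' fun i => by simp, δ, smul_inv_smul δ d', δ⁻¹ • γ • d,
        hmem _ fun i => by simp, (smul_inv_smul δ (γ • d)).symm⟩

variable [∀ i, TopologicalSpace (F i)] [∀ i, IsNonarchimedeanLocalField (F i)]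
  {C : Type*} [NormedField C] {ι : ∀ i, F i →+* C}

/-- Where `L i` is empty the stabilizer condition is void, and compactness of `ℙ¹(F i)` replaces
that of a vertex stabilizer. The limit may be rational there, since an empty `L i` cannot contain
it. -/
theorem HasLocalLimitSets.finite_stabilizer [Finite S] (hι : ∀ i, Continuous (ι i))
    (hη : ∀ i, ∃ η, η ∉ Set.range (ι i)) (hL : HasLocalLimitSets ι Γ L) (x : TreeProduct L) :
    {γ : Γ | ∀ i, γ.1 i • x.1 i = x.1 i}.Finite := by
  have hcpt : ∀ i, ∃ (y : ProjLine C) (K : Set (Fin 2 → C)), IsCompact K ∧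
      (∀ w ∈ K, ∃ hw : w ≠ 0, (L i).Nonempty →
        Projectivization.mk C w hw ∉ Set.range (projLineMap (ι i))) ∧
      ∀ g : PGL(2, F i), g • x.1 i = x.1 i → ∃ w ∈ K, ∃ hw : w ≠ 0,
        (Matrix.ProjGenLinGroup.map (ι i) g : PGL(2, C)) • y = Projectivization.mk C w hw := by
    intro i
    rcases (L i).eq_empty_or_nonempty with he | hne
    · obtain ⟨y, K, hK, h0, h⟩ := exists_isCompact_projLine (ι i) (hι i)
      exact ⟨y, K, hK, fun w hw => ⟨h0 w hw, fun hn => absurd he hn.ne_empty⟩, fun g _ => h g⟩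
    · obtain ⟨v, -, hv, -⟩ := (pair_mem_treeSimplices hne).mp (x.2 i)
      obtain ⟨η, hη⟩ := hη i
      obtain ⟨y, K, hK, h0, h⟩ := exists_isCompact_of_stabilizer (ι i) (hι i) hη v
      refine ⟨y, K, hK, fun w hw => ⟨(h0 w hw).1, fun _ => (h0 w hw).2⟩, fun g hg => h g ?_⟩
      rw [hv] at hg
      exact Option.some_injective _ hg
  choose y K hK hK0 hstab using hcpt
  by_contra hinf
  let γ := Set.Infinite.natEmbedding _ hinf
  choose w hwK hw0 hw using fun j i => hstab i ((γ j).1.1 i) ((γ j).2 i)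
  -- The subsequence is extracted among representing vectors in `C²`, and its convergence passes to
  -- the quotient.
  obtain ⟨w₀, hw₀, φ, hφ, hlim⟩ := (isCompact_pi_infinite hK).tendsto_subseq (x := w) hwK
  choose hw₀0 hirr using fun i => hK0 i (w₀ i) (hw₀ i)
  have hmem : (fun i => Projectivization.mk C (w₀ i) (hw₀0 i)) ∈ limitPoints ι Γ := by
    refine ⟨y, fun j => (γ (φ j)).1.1, ?_, fun j => (γ (φ j)).1.2, ?_⟩
    · intro a b hab
      exact hφ.injective (γ.injective (Subtype.ext (Subtype.ext hab)))
    · rw [tendsto_pi_nhds] at hlim ⊢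
      intro i
      simp only [act, hw]
      exact tendsto_projLine_mk (hlim i) _ (hw₀0 i)
  rw [hL] at hmem
  obtain ⟨i, ℓ, hℓ, he⟩ := hmem
  exact hirr i ⟨ℓ, hℓ⟩ ⟨ℓ, he⟩

end Main

end Plectic

theorem mainTheorem6
    {k : Type*} [NontriviallyNormedField k] [IsUltrametricDist k] [ProperSpace k]
    {S : Type*} [Finite S] [Nonempty S]
    {F : S → Type*} [∀ i, Field (F i)] [∀ i, ValuativeRel (F i)] [∀ i, TopologicalSpace (F i)]
    [∀ i, IsNonarchimedeanLocalField (F i)]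
    (ι : ∀ i, F i →+* Plectic.CompletedAlgClosure k) (hι : ∀ i, Continuous (ι i))
    (Γ : Subgroup (∀ i, Matrix.ProjGenLinGroup (Fin 2) (F i)))
    (hΓ : Plectic.IsNormalPlectic ι Γ) :
    Group.IsFinitelyPresented Γ := by
  obtain ⟨L, hlim, hL, hfin⟩ := hΓ
  have hη : ∀ i, ∃ η, η ∉ Set.range (ι i) := fun i =>
    Plectic.exists_notMem_range k (ι i) (hι i)
  have hirr : ∀ i, ∃ z, z ∉ Set.range (Plectic.projLineMap (ι i)) := fun i => by
    obtain ⟨η, hη⟩ := hη i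
    exact ⟨_, Plectic.mk_one_notMem_range (ι i) hη fun h => one_ne_zero (congrFun h 0)⟩
  exact Plectic.isFinitelyPresented_of_finite_stabilizer hL
    (fun γ hγ i ℓ hℓ => hlim.smul_mem hirr hγ hℓ) hfin (hlim.finite_stabilizer hι hη)
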